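/- Let $d\ge 0$. Normalize the Fourier transform on the Schwartz space $\mathcal S(\mathbb R^d)$ by $(\mathcal F\varphi)(\lambda)=(2\pi)^{-d/2}\int_{\mathbb R^d}\varphi(x)e^{-i\lambda\cdot x}\,dx$, and extend it to tempered distributions by $\langle\mathcal F T,\varphi\rangle=\langle T,\mathcal F\varphi\rangle$. A function $f:\mathbb R^d\to\mathbb C$ is said to be the Fourier transform of a tempered distribution $T$ if $f$ is continuous, $f\varphi$ is integrable for every $\varphi\in\mathcal S(\mathbb R^d)$, and $\langle \mathcal F T,\varphi\rangle=\int f\varphi\,dx$ for all such $\varphi$; we then write $T=\mathcal F^{-1}f$. The order of a distribution $T$ is the least $N\in\mathbb N_0$ (if any) such that for every compact $K\subset\mathbb R^d$ there is a constant $C$ with $|\langle T,\varphi\rangle|\le C\sum_{k\le N}\sup_{x}\|D^k\varphi(x)\|$ for all smooth $\varphi$ supported in $K$. For a nonempty compact set $A\subset\mathbb R^d$ put $H_A(y)=\max_{a\in A}a\cdot y$ for $y\in\mathbb R^d$. Theorem. Let $A$ be a nonempty compact convex subset of $\mathbb R^d$ that is symmetric ($-A=A$), and let $f:\mathbb R^d\to\mathbb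 C$. Then the following are equivalent: (a) $f$ is the Fourier transform of a (necessarily tempered) distribution with support contained in $A$; (b) $f$ extends to an entire function on $\mathbb C^d$, and there exist an integer $N\in\mathbb N_0$ and a constant $C$ such that $|f(z)|\le C(1+|z|)^N e^{H_A(\operatorname{Im} z)}$ for all $z\in\mathbb C^d$. If this is the case, then the distribution $\mathcal F^{-1}f$ has finite order, and the integer $N$ in (b) can be taken to be the order of $\mathcal F^{-1}f$. -/

import Mathlib

open scoped SchwartzMap FourierTransform RealInnerProductSpace
open MeasureTheory

namespace ComplexPaleyWiener

/-- The Fourier transform on Schwartz functions on `ℝ^d`, normalized as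
`(ℱ φ)(ξ) = (2π)^{-d/2} ∫ φ(x) e^{-i ξ·x} dx` (see `fourierSchwartz_apply`). It is obtained from
Mathlib's Fourier transform, whose kernel is `e^{-2πi ξ·x}`, by rescaling. -/
noncomputable def fourierSchwartz (d : ℕ) :
    𝓢(EuclideanSpace ℝ (Fin d), ℂ) →L[ℂ] 𝓢(EuclideanSpace ℝ (Fin d), ℂ) :=
  ((((2 * Real.pi) ^ ((d : ℝ) / 2))⁻¹ : ℝ) : ℂ) •
    ((SchwartzMap.compCLMOfContinuousLinearEquiv ℂ
      (ContinuousLinearEquiv.smulLeft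
        (Units.mk0 ((2 * Real.pi)⁻¹ : ℝ) (inv_ne_zero Real.two_pi_pos.ne')))).comp
      (FourierTransform.fourierCLM ℂ 𝓢(EuclideanSpace ℝ (Fin d), ℂ)))

theorem fourierSchwartz_apply (d : ℕ) (φ : 𝓢(EuclideanSpace ℝ (Fin d), ℂ))
    (ξ : EuclideanSpace ℝ (Fin d)) :
    fourierSchwartz d φ ξ =
      ((((2 * Real.pi) ^ ((d : ℝ) / 2))⁻¹ : ℝ) : ℂ) *
        ∫ x : EuclideanSpace ℝ (Fin d), φ x * Complex.exp (-Complex.I * (⟪ξ, x⟫ : ℝ)) := by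
  have h : fourierSchwartz d φ ξ = ((((2 * Real.pi) ^ ((d : ℝ) / 2))⁻¹ : ℝ) : ℂ) *
      (𝓕 (φ : EuclideanSpace ℝ (Fin d) → ℂ)) ((2 * Real.pi)⁻¹ • ξ) := rfl
  rw [h, Real.fourier_eq']
  congr 1
  refine integral_congr_ae (Filter.Eventually.of_forall fun x => ?_)
  have hpi : (2 * Real.pi) ≠ 0 := Real.two_pi_pos.ne'
  have e : -2 * Real.pi * ⟪x, (2 * Real.pi)⁻¹ • ξ⟫ = -⟪ξ, x⟫ := by
    rw [inner_smul_right, real_inner_comm]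
    field_simp
  simp only [e, smul_eq_mul]
  rw [mul_comm]
  congr 2
  push_cast
  ring

/-- The Fourier transform of a tempered distribution, `⟨ℱ T, φ⟩ = ⟨T, ℱ φ⟩`. -/
noncomputable def fourierTempered (d : ℕ) :
    𝓢'(EuclideanSpace ℝ (Fin d), ℂ) →L[ℂ] 𝓢'(EuclideanSpace ℝ (Fin d), ℂ) :=
  PointwiseConvergenceCLM.precomp ℂ (fourierSchwartz d)

theorem fourierTempered_apply (d : ℕ) (T : 𝓢'(EuclideanSpace ℝ (Fin d), ℂ))
    (φ : 𝓢(EuclideanSpace ℝ (Fin d), ℂ)) :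
    fourierTempered d T φ = T (fourierSchwartz d φ) := rfl

/-- The function `f` is the Fourier transform of the tempered distribution `T`: `f` is the
continuous function representing `ℱ T`. (Without continuity, `f` would be determined only up to
modification on a null set.) -/
def IsFourierTransformOf {d : ℕ} (f : EuclideanSpace ℝ (Fin d) → ℂ)
    (T : 𝓢'(EuclideanSpace ℝ (Fin d), ℂ)) : Prop :=
  Continuous f ∧
    ∀ φ : 𝓢(EuclideanSpace ℝ (Fin d), ℂ),
      Integrable (fun x => f x * φ x) ∧ fourierTempered d T φ = ∫ x, f x * φ x

/-- `T` has order at most `N`: for every compact `K` there is `C` such that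
`|⟨T, φ⟩| ≤ C ∑_{k ≤ N} sup_x ‖D^k φ(x)‖` for all smooth `φ` supported in `K`.
(`SchwartzMap.seminorm ℂ 0 k φ` is `sup_x ‖D^k φ(x)‖`, and a Schwartz function with support in a
compact set is the same thing as a smooth function with support in that set.) -/
def HasOrderAtMost {d : ℕ} (T : 𝓢'(EuclideanSpace ℝ (Fin d), ℂ)) (N : ℕ) : Prop :=
  ∀ K : Set (EuclideanSpace ℝ (Fin d)), IsCompact K → ∃ C : ℝ,
    ∀ φ : 𝓢(EuclideanSpace ℝ (Fin d), ℂ), tsupport φ ⊆ K →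
      ‖T φ‖ ≤ C * ∑ k ∈ Finset.range (N + 1), SchwartzMap.seminorm ℂ 0 k φ

/-- `N` is the order of `T`: the least `N` such that `T` has order at most `N`. -/
def HasOrder {d : ℕ} (T : 𝓢'(EuclideanSpace ℝ (Fin d), ℂ)) (N : ℕ) : Prop :=
  IsLeast {n : ℕ | HasOrderAtMost T n} N

/-- The supporting function `H_A(x) = max_{a ∈ A} a·x`
(the supremum is a maximum for nonempty compact `A`). -/
noncomputable def supportingFunction {d : ℕ} (A : Set (EuclideanSpace ℝ (Fin d)))
    (x : EuclideanSpace ℝ (Fin d)) : ℝ :=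
  sSup ((fun a => ⟪a, x⟫) '' A)

/-- The inclusion `ℝ^d ⊆ ℂ^d`. -/
noncomputable def realToComplex {d : ℕ} (x : EuclideanSpace ℝ (Fin d)) :
    EuclideanSpace ℂ (Fin d) :=
  WithLp.toLp 2 fun j => (x j : ℂ)

/-- The imaginary part `Im z ∈ ℝ^d` of `z ∈ ℂ^d`. -/
noncomputable def imPart {d : ℕ} (z : EuclideanSpace ℂ (Fin d)) : EuclideanSpace ℝ (Fin d) :=
  WithLp.toLp 2 fun j => (z j).im

/-- `f` extends to an entire function `F` on `ℂ^d` such that, for some constant `C`,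
`|F(z)| ≤ C (1 + |z|)^N e^{H_A(Im z)}` for all `z ∈ ℂ^d`. -/
def ExtendsEntireWithBound {d : ℕ} (A : Set (EuclideanSpace ℝ (Fin d)))
    (f : EuclideanSpace ℝ (Fin d) → ℂ) (N : ℕ) : Prop :=
  ∃ F : EuclideanSpace ℂ (Fin d) → ℂ,
    Differentiable ℂ F ∧ (∀ x, F (realToComplex x) = f x) ∧
      ∃ C : ℝ, ∀ z, ‖F z‖ ≤ C * (1 + ‖z‖) ^ N * Real.exp (supportingFunction A (imPart z))

end ComplexPaleyWiener

/-!
Let `T` be supported in `A` and let `χ` be a cutoff function equal to `1` near `A`. The entire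
extension of `f` is the Fourier-Laplace transform `F z = (2π)^{-d/2} T (χ e^{-i z·x})`; it agrees
with `f` on `ℝ^d` because both arise as limits of `⟨ℱ T, ψ⟩` for `ψ` concentrating at a point. The
number `F z` does not depend on the choice of `χ`, and when `χ` is supported at distance
`O((1 + |z|)⁻¹)` from `A`, each of the at most `N` derivatives of `χ e^{-i z·x}` costs a factor
`1 + |z|`, while `e^{x · Im z}` exceeds `e^{H_A(Im z)}` by at most a constant factor on the support.

Conversely, `F` has polynomial growth on `ℝ^d`, so `f` is the Fourier transform of some `T`. If `φ`
is supported where `x · v ≥ H_A(v) + ε`, then `T φ = ∫ F(x) (ℱ⁻¹ φ)(x) dx`, and moving the contour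
to `ℝ^d + i t v` shows that this is `O(e^{-t ε})` as `t → ∞`, hence zero. Since the convex set `A`
is an intersection of half-spaces, `T` is supported in `A`.
-/

namespace ComplexPaleyWiener

section Calculus

variable {E : Type*} [NormedAddCommGroup E] [NormedSpace ℝ E]

theorem norm_iteratedFDeriv_comp_clm_le {u : ℂ → ℂ} {n : ℕ} (hu : ContDiff ℂ n u)
    (l : E →L[ℝ] ℂ) (x : E) :
    ‖iteratedFDeriv ℝ n (fun x => u (l x)) x‖ ≤ ‖l‖ ^ n * ‖iteratedDeriv n u (l x)‖ := by
  have hcomp : iteratedFDeriv ℝ n (fun x => u (l x)) x =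
      (iteratedFDeriv ℝ n u (l x)).compContinuousLinearMap fun _ => l :=
    l.iteratedFDeriv_comp_right (hu.restrict_scalars ℝ) x le_rfl
  have hnorm : ‖iteratedFDeriv ℝ n u (l x)‖ = ‖iteratedDeriv n u (l x)‖ := by
    rw [← hu.contDiffAt.restrictScalars_iteratedFDeriv, Function.comp_apply,
      ContinuousMultilinearMap.norm_restrictScalars, norm_iteratedFDeriv_eq_norm_iteratedDeriv]
  rw [hcomp, ← hnorm, mul_comm]
  simpa using (iteratedFDeriv ℝ n u (l x)).norm_compContinuousLinearMap_le fun _ => l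

theorem norm_iteratedFDeriv_cexp_clm_le (l : E →L[ℝ] ℂ) (n : ℕ) (x : E) :
    ‖iteratedFDeriv ℝ n (fun x => Complex.exp (l x)) x‖ ≤ ‖l‖ ^ n * Real.exp (l x).re := by
  simpa [iteratedDeriv_eq_iterate, Complex.norm_exp]
    using norm_iteratedFDeriv_comp_clm_le Complex.contDiff_exp (n := n) l x

theorem norm_iteratedFDeriv_clm_le (l : E →L[ℝ] ℂ) (n : ℕ) (x : E) :
    ‖iteratedFDeriv ℝ n l x‖ ≤ ‖l‖ * (1 + ‖x‖) := by
  rcases n with _ | _ | n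
  · rw [norm_iteratedFDeriv_zero]
    exact (l.le_opNorm x).trans (by gcongr; linarith)
  · rw [norm_iteratedFDeriv_one, l.fderiv]
    exact le_mul_of_one_le_right (norm_nonneg _) (by linarith [norm_nonneg x])
  · refine (norm_iteratedFDeriv_comp_clm_le contDiff_id l x).trans ?_
    rw [iteratedDeriv_succ', deriv_id', iteratedDeriv_succ', deriv_const',
      iteratedDeriv_fun_const_zero, norm_zero, mul_zero]
    positivity

theorem norm_iteratedDeriv_cexp_sub_one_sub_id_le {w : ℂ} (hw : ‖w‖ ≤ 1) (n : ℕ) :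
    ‖iteratedDeriv n (fun w => Complex.exp w - 1 - w) w‖ ≤ 3 * ‖w‖ ^ (2 - n) := by
  have h1 : deriv (fun w => Complex.exp w - 1 - w) = fun w => Complex.exp w - 1 :=
    funext fun w => (((Complex.hasDerivAt_exp w).sub_const 1).sub (hasDerivAt_id w)).deriv
  have h2 : deriv (fun w => Complex.exp w - 1) = Complex.exp :=
    funext fun w => ((Complex.hasDerivAt_exp w).sub_const 1).deriv
  rcases n with _ | _ | n
  · rw [iteratedDeriv_zero]
    exact (Complex.norm_exp_sub_one_sub_id_le hw).trans
      (le_mul_of_one_le_left (sq_nonneg _) (by norm_num))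
  · rw [zero_add, iteratedDeriv_one, h1, pow_one]
    exact (Complex.norm_exp_sub_one_le hw).trans (by gcongr; norm_num)
  · rw [iteratedDeriv_succ', h1, iteratedDeriv_succ', h2, iteratedDeriv_eq_iterate,
      Complex.iter_deriv_exp, Complex.norm_exp]
    calc Real.exp w.re ≤ Real.exp 1 := by
          gcongr
          exact (Complex.re_le_norm w).trans hw
      _ ≤ 3 * ‖w‖ ^ (2 - (n + 1 + 1)) := by
          rw [show 2 - (n + 1 + 1) = 0 by lia, pow_zero]
          linarith [Real.exp_one_lt_d9]

theorem norm_iteratedFDeriv_cexp_clm_sub_one_sub_le {R : ℝ} (hR : 1 ≤ R) {l : E →L[ℝ] ℂ}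
    (hl : ‖l‖ * R ≤ 1) (n : ℕ) {x : E} (hx : ‖x‖ ≤ R) :
    ‖iteratedFDeriv ℝ n (fun x => Complex.exp (l x) - 1 - l x) x‖ ≤ 3 * R ^ 2 * ‖l‖ ^ 2 := by
  have hlx : ‖l x‖ ≤ ‖l‖ * R := (l.le_opNorm x).trans (by gcongr)
  have hl1 : ‖l‖ ≤ 1 := by nlinarith [norm_nonneg l]
  have hsmooth : ContDiff ℂ n fun w : ℂ => Complex.exp w - 1 - w :=
    (Complex.contDiff_exp.sub contDiff_const).sub contDiff_id
  calc ‖iteratedFDeriv ℝ n (fun x => Complex.exp (l x) - 1 - l x) x‖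
    _ ≤ ‖l‖ ^ n * ‖iteratedDeriv n (fun w => Complex.exp w - 1 - w) (l x)‖ :=
        norm_iteratedFDeriv_comp_clm_le hsmooth l x
    _ ≤ ‖l‖ ^ n * (3 * ‖l x‖ ^ (2 - n)) := by
        gcongr
        exact norm_iteratedDeriv_cexp_sub_one_sub_id_le (hlx.trans hl) n
    _ ≤ ‖l‖ ^ n * (3 * (‖l‖ * R) ^ (2 - n)) := by gcongr
    _ = 3 * R ^ (2 - n) * ‖l‖ ^ (n + (2 - n)) := by rw [mul_pow, pow_add]; ring
    _ ≤ 3 * R ^ 2 * ‖l‖ ^ 2 := by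
        gcongr 3 * ?_ * ?_
        · exact pow_le_pow_right₀ hR (Nat.sub_le 2 n)
        · exact pow_le_pow_of_le_one (norm_nonneg l) hl1 (by lia)

end Calculus

section Schwartz

open scoped ContDiff Topology
open Filter

variable {E : Type*} [NormedAddCommGroup E] [NormedSpace ℝ E]

theorem exists_seminorm_mul_le (χ : 𝓢(E, ℂ)) (k n : ℕ) :
    ∃ C : ℝ, 0 ≤ C ∧ ∀ (h : E → ℂ) (B : ℝ), ContDiff ℝ ∞ h → 0 ≤ B →
      (∀ x ∈ tsupport χ, ∀ j ≤ n, ‖iteratedFDeriv ℝ j h x‖ ≤ B * (1 + ‖x‖)) →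
      ∀ φ : 𝓢(E, ℂ), (∀ x, φ x = χ x * h x) → SchwartzMap.seminorm ℂ k n φ ≤ C * B := by
  refine ⟨∑ i ∈ Finset.range (n + 1), (n.choose i : ℝ) *
    (SchwartzMap.seminorm ℂ k i χ + SchwartzMap.seminorm ℂ (k + 1) i χ), by positivity, ?_⟩
  intro h B hh hB hbound φ hφ
  refine SchwartzMap.seminorm_le_bound ℂ k n φ (by positivity) fun x => ?_
  rw [show (φ : E → ℂ) = fun x => χ x * h x from funext hφ]
  by_cases hx : x ∈ tsupport χ
  · calc ‖x‖ ^ k * ‖iteratedFDeriv ℝ n (fun x => χ x * h x) x‖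
      _ ≤ ‖x‖ ^ k * ∑ i ∈ Finset.range (n + 1), (n.choose i : ℝ) *
          ‖iteratedFDeriv ℝ i χ x‖ * ‖iteratedFDeriv ℝ (n - i) h x‖ := by
          gcongr
          exact norm_iteratedFDeriv_mul_le (χ.smooth ⊤) hh x (mod_cast le_top)
      _ ≤ ‖x‖ ^ k * ∑ i ∈ Finset.range (n + 1), (n.choose i : ℝ) *
          ‖iteratedFDeriv ℝ i χ x‖ * (B * (1 + ‖x‖)) := by
          gcongr with i _
          exact hbound x hx _ (Nat.sub_le _ _)
      _ = ∑ i ∈ Finset.range (n + 1), (n.choose i : ℝ) *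
          (‖x‖ ^ k * ‖iteratedFDeriv ℝ i χ x‖ + ‖x‖ ^ (k + 1) * ‖iteratedFDeriv ℝ i χ x‖) * B := by
          rw [Finset.mul_sum]
          exact Finset.sum_congr rfl fun i _ => by ring
      _ ≤ _ := by
          rw [Finset.sum_mul]
          gcongr with i _
          · exact SchwartzMap.le_seminorm ℂ k i χ x
          · exact SchwartzMap.le_seminorm ℂ (k + 1) i χ x
  · rw [image_eq_zero_of_notMem_tsupport fun hx' => hx (tsupport_mul_subset_left
      (tsupport_iteratedFDeriv_subset n hx')), norm_zero, mul_zero]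
    positivity

theorem exists_norm_apply_le_finset_sup (T : 𝓢(E, ℂ) →L[ℂ] ℂ) :
    ∃ (s : Finset (ℕ × ℕ)) (C : ℝ), 0 ≤ C ∧
      ∀ φ, ‖T φ‖ ≤ C * s.sup (schwartzSeminormFamily ℂ E ℂ) φ := by
  obtain ⟨s, C, -, hs⟩ := Seminorm.bound_of_continuous (schwartz_withSeminorms ℂ E ℂ)
    ((normSeminorm ℂ ℂ).comp T.toLinearMap) T.continuous.norm
  exact ⟨s, C, C.2, hs⟩

theorem exists_norm_apply_mul_le (T : 𝓢(E, ℂ) →L[ℂ] ℂ) (χ : 𝓢(E, ℂ)) :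
    ∃ (C : ℝ) (M : ℕ), 0 ≤ C ∧ ∀ (h : E → ℂ) (B : ℝ), ContDiff ℝ ∞ h → 0 ≤ B →
      (∀ x ∈ tsupport χ, ∀ j ≤ M, ‖iteratedFDeriv ℝ j h x‖ ≤ B * (1 + ‖x‖)) →
      ∀ φ : 𝓢(E, ℂ), (∀ x, φ x = χ x * h x) → ‖T φ‖ ≤ C * B := by
  obtain ⟨s, C, hC, hs⟩ := exists_norm_apply_le_finset_sup T
  choose D hD0 hD using exists_seminorm_mul_le χ
  refine ⟨C * ∑ p ∈ s, D p.1 p.2, s.sup Prod.snd,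
    mul_nonneg hC (Finset.sum_nonneg fun p _ => hD0 _ _), fun h B hh hB hbound φ hφ => ?_⟩
  refine (hs φ).trans ?_
  rw [mul_assoc]
  gcongr
  refine Seminorm.finset_sup_apply_le
    (mul_nonneg (Finset.sum_nonneg fun p _ => hD0 _ _) hB) fun p hp => ?_
  calc SchwartzMap.seminorm ℂ p.1 p.2 φ
    _ ≤ D p.1 p.2 * B := hD _ _ h B hh hB
        (fun x hx j hj => hbound x hx j (hj.trans (Finset.le_sup (f := Prod.snd) hp))) φ hφ
    _ ≤ (∑ p ∈ s, D p.1 p.2) * B := by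
        gcongr
        exact Finset.single_le_sum (f := fun p => D p.1 p.2) (fun p _ => hD0 _ _) hp

theorem norm_iteratedFDeriv_dilation_sub_le (θ : 𝓢(E, ℂ)) {ε : ℝ} (hε : |ε| ≤ 1) (j : ℕ)
    (x : E) :
    ‖iteratedFDeriv ℝ j (fun x => θ (ε • x) - θ 0) x‖ ≤
      (SchwartzMap.seminorm ℂ 0 1 θ + SchwartzMap.seminorm ℂ 0 j θ) * |ε| * (1 + ‖x‖) := by
  rcases j with _ | j
  · have hlip := convex_univ.norm_image_sub_le_of_norm_fderiv_le (𝕜 := ℝ) (f := θ)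
      (C := SchwartzMap.seminorm ℂ 0 1 θ) (x := 0) (y := ε • x) (fun x _ => θ.differentiableAt)
      (fun x _ => by
        rw [← norm_iteratedFDeriv_one]
        exact SchwartzMap.norm_iteratedFDeriv_le_seminorm ℂ θ 1 x) trivial trivial
    rw [sub_zero, norm_smul, Real.norm_eq_abs, ← mul_assoc] at hlip
    rw [norm_iteratedFDeriv_zero]
    refine hlip.trans ?_
    gcongr
    · exact le_add_of_nonneg_right (by positivity)
    · linarith
  · have hcomp : iteratedFDeriv ℝ (j + 1) (fun x => θ (ε • x) - θ 0) x =
        ε ^ (j + 1) • iteratedFDeriv ℝ (j + 1) θ (ε • x) := by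
      have hsmooth : ContDiffAt ℝ (j + 1 : ℕ) (fun x => θ (ε • x)) x :=
        ((θ.smooth _).comp (contDiff_const_smul ε)).contDiffAt
      rw [fun_iteratedFDeriv_sub_apply hsmooth contDiffAt_const,
        iteratedFDeriv_const_of_ne (Nat.succ_ne_zero j), Pi.zero_apply, sub_zero,
        iteratedFDeriv_comp_const_smul ε (θ.smooth _)]
    rw [hcomp, norm_smul, norm_pow, Real.norm_eq_abs]
    calc |ε| ^ (j + 1) * ‖iteratedFDeriv ℝ (j + 1) θ (ε • x)‖
      _ ≤ |ε| * SchwartzMap.seminorm ℂ 0 (j + 1) θ := by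
          gcongr
          · exact pow_le_of_le_one (abs_nonneg ε) hε (Nat.succ_ne_zero j)
          · exact SchwartzMap.norm_iteratedFDeriv_le_seminorm ℂ θ (j + 1) _
      _ = SchwartzMap.seminorm ℂ 0 (j + 1) θ * |ε| * 1 := by ring
      _ ≤ _ := by
          gcongr
          · exact le_add_of_nonneg_left (by positivity)
          · linarith [norm_nonneg x]

theorem hasTemperateGrowth_dilation (θ : 𝓢(E, ℂ)) (ε : ℝ) :
    (fun x => θ (ε • x)).HasTemperateGrowth :=
  θ.hasTemperateGrowth.comp (ε • ContinuousLinearMap.id ℝ E).hasTemperateGrowth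

theorem tendsto_apply_smulLeftCLM_dilation (T : 𝓢(E, ℂ) →L[ℂ] ℂ) (φ θ : 𝓢(E, ℂ)) :
    Tendsto (fun ε : ℝ => T (SchwartzMap.smulLeftCLM ℂ (fun x => θ (ε • x)) φ)) (𝓝 0)
      (𝓝 (θ 0 * T φ)) := by
  obtain ⟨C, M, -, hCM⟩ := exists_norm_apply_mul_le T φ
  set D : ℝ := SchwartzMap.seminorm ℂ 0 1 θ +
    ∑ j ∈ Finset.range (M + 1), SchwartzMap.seminorm ℂ 0 j θ
  have hlim : Tendsto (fun ε : ℝ => C * (D * |ε|)) (𝓝 0) (𝓝 0) :=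
    (by fun_prop : Continuous fun ε : ℝ => C * (D * |ε|)).tendsto' 0 0 (by simp)
  rw [tendsto_iff_norm_sub_tendsto_zero]
  refine squeeze_zero' (.of_forall fun _ => norm_nonneg _) ?_ hlim
  filter_upwards [Metric.ball_mem_nhds (0 : ℝ) one_pos] with ε hε
  have hε1 : |ε| ≤ 1 := (mem_ball_zero_iff.1 hε).le
  rw [← smul_eq_mul, ← map_smul, ← map_sub]
  refine hCM (fun x => θ (ε • x) - θ 0) (D * |ε|)
    (((θ.smooth ⊤).comp (contDiff_const_smul ε)).sub contDiff_const) (by positivity)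
    (fun x _ j hj => ?_) _ fun x => ?_
  · refine (norm_iteratedFDeriv_dilation_sub_le θ hε1 j x).trans ?_
    gcongr
    exact add_le_add le_rfl (Finset.single_le_sum (f := fun j => SchwartzMap.seminorm ℂ 0 j θ)
      (fun _ _ => by positivity) (Finset.mem_range.2 (Nat.lt_succ_of_le hj)))
  · rw [sub_apply, smul_apply,
      SchwartzMap.smulLeftCLM_apply_apply (hasTemperateGrowth_dilation θ ε), smul_eq_mul,
      smul_eq_mul]
    ring

end Schwartz

section Cutoff

open scoped ContDiff Convolution
open Metric

section Convolution

theorem continuousLinearEquiv_comp_lsmul_convolution {E F G : Type*} [Sub E] [MeasurableSpace E]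
    [NormedAddCommGroup F] [NormedSpace ℝ F] [NormedAddCommGroup G] [NormedSpace ℝ G]
    (L : F ≃L[ℝ] G) (μ : Measure E) (u : E → ℝ) (g : E → F) :
    L ∘ (u ⋆[ContinuousLinearMap.lsmul ℝ ℝ, μ] g) =
      u ⋆[ContinuousLinearMap.lsmul ℝ ℝ, μ] (L ∘ g) := by
  ext1 x
  simp only [Function.comp_apply, convolution_def, ContinuousLinearMap.lsmul_apply, ← map_smul]
  exact (L.integral_comp_comm _).symm

variable {E F : Type*} [NormedAddCommGroup E] [NormedSpace ℝ E] [FiniteDimensional ℝ E]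
  [MeasurableSpace E] [BorelSpace E] [NormedAddCommGroup F] [NormedSpace ℝ F]
  {μ : Measure E} [μ.IsAddHaarMeasure] {u : E → ℝ}

theorem fderiv_lsmul_convolution (hu : LocallyIntegrable u μ) {ψ : E → F} (hψ : ContDiff ℝ 1 ψ)
    (hc : HasCompactSupport ψ) :
    fderiv ℝ (u ⋆[ContinuousLinearMap.lsmul ℝ ℝ, μ] ψ) =
      u ⋆[ContinuousLinearMap.lsmul ℝ ℝ, μ] fderiv ℝ ψ := by
  ext1 x
  rw [(hc.hasFDerivAt_convolution_right _ hu hψ x).fderiv]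
  rfl

theorem iteratedFDeriv_lsmul_convolution (hu : LocallyIntegrable u μ) {ψ : E → F}
    (hψ : ContDiff ℝ ∞ ψ) (hc : HasCompactSupport ψ) (k : ℕ) :
    iteratedFDeriv ℝ k (u ⋆[ContinuousLinearMap.lsmul ℝ ℝ, μ] ψ) =
      u ⋆[ContinuousLinearMap.lsmul ℝ ℝ, μ] iteratedFDeriv ℝ k ψ := by
  induction k with
  | zero =>
    rw [iteratedFDeriv_zero_eq_comp, iteratedFDeriv_zero_eq_comp]
    exact continuousLinearEquiv_comp_lsmul_convolution
      (continuousMultilinearCurryFin0 ℝ E F).symm.toContinuousLinearEquiv μ u ψ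
  | succ k ih =>
    rw [iteratedFDeriv_succ_eq_comp_left, iteratedFDeriv_succ_eq_comp_left, ih,
      fderiv_lsmul_convolution hu (hψ.iteratedFDeriv_right (mod_cast le_top))
        (hc.iteratedFDeriv k)]
    exact continuousLinearEquiv_comp_lsmul_convolution (F := E →L[ℝ] E [×k]→L[ℝ] F)
      (G := E [×(k + 1)]→L[ℝ] F) (continuousMultilinearCurryLeftEquiv ℝ
        (fun _ : Fin (k + 1) => E) F).symm.toContinuousLinearEquiv μ u _

theorem norm_lsmul_convolution_le (hu : ∀ x, ‖u x‖ ≤ 1) {g : E → F} (hg : Integrable g μ) (x : E) :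
    ‖(u ⋆[ContinuousLinearMap.lsmul ℝ ℝ, μ] g) x‖ ≤ ∫ y, ‖g y‖ ∂μ := by
  rw [convolution_def, ← integral_sub_left_eq_self (fun y => ‖g y‖) μ x]
  refine norm_integral_le_of_norm_le (hg.norm.comp_sub_left x) (.of_forall fun t => ?_)
  rw [ContinuousLinearMap.lsmul_apply, norm_smul]
  exact mul_le_of_le_one_left (norm_nonneg _) (hu t)

theorem norm_iteratedFDeriv_lsmul_convolution_le (hu : LocallyIntegrable u μ)
    (hu1 : ∀ x, ‖u x‖ ≤ 1) {ψ : E → F} (hψ : ContDiff ℝ ∞ ψ) (hc : HasCompactSupport ψ) (k : ℕ)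
    (x : E) :
    ‖iteratedFDeriv ℝ k (u ⋆[ContinuousLinearMap.lsmul ℝ ℝ, μ] ψ) x‖ ≤
      ∫ y, ‖iteratedFDeriv ℝ k ψ y‖ ∂μ := by
  rw [iteratedFDeriv_lsmul_convolution hu hψ hc]
  exact norm_lsmul_convolution_le hu1 ((hψ.continuous_iteratedFDeriv
    (mod_cast le_top)).integrable_of_hasCompactSupport (hc.iteratedFDeriv k)) x

end Convolution

variable (E : Type*) [NormedAddCommGroup E] [NormedSpace ℝ E] [FiniteDimensional ℝ E]

theorem exists_unit_cutoff :
    ∃ C : ℕ → ℝ, ∀ B : Set E, ∃ χ : E → ℝ, ContDiff ℝ ∞ χ ∧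
      (∀ x ∈ thickening (1 / 4) B, χ x = 1) ∧ (∀ x, χ x ≠ 0 → x ∈ thickening 1 B) ∧
      ∀ k x, ‖iteratedFDeriv ℝ k χ x‖ ≤ C k := by
  borelize E
  let μ : Measure E := Measure.addHaar
  let b : ContDiffBump (0 : E) := ⟨1 / 8, 1 / 4, by norm_num, by norm_num⟩
  have hψ : ContDiff ℝ ∞ (b.normed μ) := b.contDiff_normed
  have hc : HasCompactSupport (b.normed μ) := b.hasCompactSupport_normed
  refine ⟨fun k => ∫ y, ‖iteratedFDeriv ℝ k (b.normed μ) y‖ ∂μ, fun B => ?_⟩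
  set u : E → ℝ := (thickening (1 / 2) B).indicator 1
  have hu : LocallyIntegrable u μ :=
    (locallyIntegrable_const (1 : ℝ)).indicator isOpen_thickening.measurableSet
  have hu1 : ∀ x, ‖u x‖ ≤ 1 := fun x => (norm_indicator_le_norm_self _ _).trans (by simp)
  have hlocal : ∀ x, (∀ y ∈ ball x (1 / 4), u y = u x) →
      (u ⋆[ContinuousLinearMap.lsmul ℝ ℝ, μ] b.normed μ) x = u x := fun x hx => by
    rw [← convolution_flip, show (ContinuousLinearMap.lsmul ℝ ℝ : ℝ →L[ℝ] ℝ →L[ℝ] ℝ).flip =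
      ContinuousLinearMap.lsmul ℝ ℝ by ext; simp, b.normed_convolution_eq_right hx]
  refine ⟨u ⋆[ContinuousLinearMap.lsmul ℝ ℝ, μ] b.normed μ,
    hc.contDiff_convolution_right _ hu hψ, fun x hx => ?_, fun x hx => ?_,
    fun k x => norm_iteratedFDeriv_lsmul_convolution_le hu hu1 hψ hc k x⟩
  · have hball : ∀ y ∈ ball x (1 / 4), u y = 1 := fun y hy => by
      obtain ⟨a, ha, hxa⟩ := mem_thickening_iff.1 hx
      refine Set.indicator_of_mem (mem_thickening_iff.2 ⟨a, ha, ?_⟩) _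
      linarith [dist_triangle y x a, mem_ball.1 hy]
    have hux := hball x (mem_ball_self (by norm_num))
    rw [hlocal x fun y hy => (hball y hy).trans hux.symm, hux]
  · by_contra hx1
    have hball : ∀ y ∈ ball x (1 / 4), u y = 0 := fun y hy => by
      refine Set.indicator_of_notMem (fun hy' => hx1 ?_) _
      obtain ⟨a, ha, hya⟩ := mem_thickening_iff.1 hy'
      refine mem_thickening_iff.2 ⟨a, ha, ?_⟩
      linarith [dist_triangle_left x a y, mem_ball.1 hy]
    have hux := hball x (mem_ball_self (by norm_num))
    exact hx ((hlocal x fun y hy => (hball y hy).trans hux.symm).trans hux)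

theorem exists_cutoff :
    ∃ C : ℕ → ℝ, ∀ (B : Set E) (δ : ℝ), 0 < δ → ∃ χ : E → ℂ, ContDiff ℝ ∞ χ ∧
      (∀ x ∈ thickening (δ / 4) B, χ x = 1) ∧ (∀ x, χ x ≠ 0 → x ∈ thickening δ B) ∧
      ∀ k x, ‖iteratedFDeriv ℝ k χ x‖ ≤ C k * δ⁻¹ ^ k := by
  obtain ⟨C, hC⟩ := exists_unit_cutoff E
  refine ⟨C, fun B δ hδ => ?_⟩
  obtain ⟨χ, hsmooth, hone, hsupp, hbound⟩ := hC ((δ⁻¹ • ·) '' B)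
  have hsmooth' : ContDiff ℝ ∞ fun x => χ (δ⁻¹ • x) := hsmooth.comp (contDiff_const_smul _)
  have hmem : ∀ r x, δ⁻¹ • x ∈ thickening r ((δ⁻¹ • ·) '' B) ↔ x ∈ thickening (δ * r) B :=
    fun r x => by
      simp only [mem_thickening_iff, Set.exists_mem_image, dist_smul₀, norm_inv,
        Real.norm_of_nonneg hδ.le, inv_mul_lt_iff₀ hδ]
  refine ⟨fun x => (χ (δ⁻¹ • x) : ℂ), Complex.ofRealCLM.contDiff.comp hsmooth', fun x hx => ?_,
    fun x hx => ?_, fun k x => ?_⟩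
  · exact congrArg Complex.ofReal (hone _ ((hmem _ x).2 (by rwa [mul_one_div])))
  · simpa only [mul_one] using (hmem 1 x).1 (hsupp _ (Complex.ofReal_ne_zero.1 hx))
  · calc ‖iteratedFDeriv ℝ k (fun x => (χ (δ⁻¹ • x) : ℂ)) x‖
      _ ≤ ‖Complex.ofRealCLM‖ * ‖iteratedFDeriv ℝ k (fun x => χ (δ⁻¹ • x)) x‖ :=
          Complex.ofRealCLM.norm_iteratedFDeriv_comp_left (N := ∞) (n := k) hsmooth'.contDiffAt
            (mod_cast le_top)
      _ = ‖iteratedFDeriv ℝ k χ (δ⁻¹ • x)‖ * δ⁻¹ ^ k := by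
          rw [Complex.ofRealCLM_norm, one_mul, iteratedFDeriv_comp_const_smul _ (hsmooth.of_le
            (mod_cast le_top)), norm_smul, norm_pow, Real.norm_of_nonneg (inv_nonneg.2 hδ.le),
            mul_comm]
      _ ≤ C k * δ⁻¹ ^ k := by
          gcongr
          exact hbound k _

end Cutoff

section Support

open scoped ContDiff
open Metric Distribution

variable {E : Type*} [NormedAddCommGroup E] [NormedSpace ℝ E] [FiniteDimensional ℝ E]
  {T : 𝓢(E, ℂ) →L[ℂ] ℂ}

theorem exists_schwartz_cutoff_of_scale {K : Set E} (hK : IsCompact K) :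
    ∃ C : ℕ → ℝ, ∀ δ : ℝ, 0 < δ → ∃ χ : 𝓢(E, ℂ), HasCompactSupport χ ∧
      tsupport χ ⊆ cthickening δ K ∧ (∀ x ∈ thickening (δ / 4) K, χ x = 1) ∧
      ∀ k x, ‖iteratedFDeriv ℝ k χ x‖ ≤ C k * δ⁻¹ ^ k := by
  obtain ⟨C, hC⟩ := exists_cutoff E
  refine ⟨C, fun δ hδ => ?_⟩
  obtain ⟨χ, hsmooth, hone, hsupp, hbound⟩ := hC K δ hδ
  have hsub : tsupport χ ⊆ cthickening δ K :=
    closure_minimal (fun x hx => thickening_subset_cthickening _ _ (hsupp x hx))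
      isClosed_cthickening
  have hc : HasCompactSupport χ := hK.cthickening.of_isClosed_subset (isClosed_tsupport _) hsub
  exact ⟨hc.toSchwartzMap hsmooth, hc, hsub, hone, hbound⟩

theorem exists_schwartz_cutoff {K U : Set E} (hK : IsCompact K) (hU : IsOpen U) (hKU : K ⊆ U) :
    ∃ χ : 𝓢(E, ℂ), HasCompactSupport χ ∧ tsupport χ ⊆ U ∧
      ∃ δ > 0, ∀ x ∈ thickening δ K, χ x = 1 := by
  obtain ⟨δ, hδ, hδU⟩ := hK.exists_cthickening_subset_open hU hKU
  obtain ⟨_, hC⟩ := exists_schwartz_cutoff_of_scale hK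
  obtain ⟨χ, hχ, hsub, hone, -⟩ := hC δ hδ
  exact ⟨χ, hχ, hsub.trans hδU, δ / 4, by positivity, hone⟩

theorem isVanishingOn_of_hasCompactSupport {s : Set E}
    (h : ∀ φ : 𝓢(E, ℂ), HasCompactSupport φ → tsupport φ ⊆ s → T φ = 0) :
    IsVanishingOn T s := fun φ hφ => by
  obtain ⟨θ, hθ, -, δ, hδ, hone⟩ := exists_schwartz_cutoff (isCompact_singleton (x := (0 : E)))
    isOpen_univ (Set.subset_univ _)
  have hθ0 : θ 0 = 1 := hone 0 (self_subset_thickening hδ _ rfl)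
  have hlim := (tendsto_apply_smulLeftCLM_dilation T φ θ).mono_left
    (nhdsWithin_le_nhds (s := {0}ᶜ))
  rw [hθ0, one_mul] at hlim
  refine tendsto_nhds_unique hlim (tendsto_const_nhds.congr' ?_)
  filter_upwards [self_mem_nhdsWithin] with ε hε
  have hsub := SchwartzMap.tsupport_smulLeftCLM_subset (F := ℂ) (fun x => θ (ε • x)) φ
  have hc : HasCompactSupport fun x => θ (ε • x) := hθ.comp_smul hε
  exact (h _ (hc.of_isClosed_subset (isClosed_tsupport _) (hsub.trans Set.inter_subset_right))
    ((hsub.trans Set.inter_subset_left).trans hφ)).symm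

theorem isVanishingOn_union {U V : Set E} (hU : IsOpen U) (hV : IsOpen V)
    (hTU : IsVanishingOn T U) (hTV : IsVanishingOn T V) : IsVanishingOn T (U ∪ V) :=
  isVanishingOn_of_hasCompactSupport fun φ hφ hφUV => by
  obtain ⟨χ, -, hχU, δ, hδ, hone⟩ := exists_schwartz_cutoff (hφ.diff hV) hU
    fun x hx => (hφUV hx.1).resolve_right hx.2
  set ψ := SchwartzMap.smulLeftCLM ℂ χ φ
  have hψ : ∀ x, ψ x = χ x * φ x := SchwartzMap.smulLeftCLM_apply_apply χ.hasTemperateGrowth φ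
  have hψU : tsupport ψ ⊆ U :=
    (SchwartzMap.tsupport_smulLeftCLM_subset _ _).trans (Set.inter_subset_right.trans hχU)
  have hφψV : tsupport (φ - ψ : 𝓢(E, ℂ)) ⊆ V := fun x hx => by
    by_contra hxV
    refine notMem_tsupport_iff_eventuallyEq.2 ?_ hx
    by_cases hxφ : x ∈ tsupport φ
    · filter_upwards [isOpen_thickening.mem_nhds
        (self_subset_thickening hδ (tsupport φ \ V) ⟨hxφ, hxV⟩)] with y hy
      rw [sub_apply, hψ, hone y hy, one_mul, sub_self, Pi.zero_apply]
    · filter_upwards [notMem_tsupport_iff_eventuallyEq.1 hxφ] with y hy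
      rw [sub_apply, hψ, hy, Pi.zero_apply, mul_zero, sub_zero]
  rw [← add_sub_cancel ψ φ, map_add, hTU ψ hψU, hTV _ hφψV, add_zero]

theorem isVanishingOn_compl_dsupport : IsVanishingOn T (dsupport T)ᶜ :=
  isVanishingOn_of_hasCompactSupport fun φ hφ hφT => by
  suffices h : ∃ V, tsupport φ ⊆ V ∧ IsOpen V ∧ IsVanishingOn T V by
    obtain ⟨V, hφV, -, hV⟩ := h
    exact hV φ hφV
  refine IsCompact.induction_on hφ (p := fun s => ∃ V, s ⊆ V ∧ IsOpen V ∧ IsVanishingOn T V)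
    ⟨∅, subset_rfl, isOpen_empty, fun ψ hψ => ?_⟩ ?_ ?_ fun x hx => ?_
  · rw [show ψ = 0 from SchwartzMap.ext fun x => image_eq_zero_of_notMem_tsupport fun hx => hψ hx,
      map_zero]
  · rintro s t hst ⟨V, htV, hV⟩
    exact ⟨V, hst.trans htV, hV⟩
  · rintro s t ⟨U, hsU, hU, hTU⟩ ⟨V, htV, hV, hTV⟩
    exact ⟨U ∪ V, Set.union_subset_union hsU htV, hU.union hV, isVanishingOn_union hU hV hTU hTV⟩
  · obtain ⟨V, hTV, hV, hxV⟩ := (notMem_dsupport_iff x).1 (hφT hx)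
    exact ⟨V, mem_nhdsWithin_of_mem_nhds (hV.mem_nhds hxV), V, subset_rfl, hV, hTV⟩

theorem apply_congr_of_eqOn_thickening {A : Set E} (hT : dsupport T ⊆ A) {δ : ℝ} (hδ : 0 < δ)
    {φ ψ : 𝓢(E, ℂ)} (h : Set.EqOn φ ψ (thickening δ A)) : T φ = T ψ := by
  rw [← sub_eq_zero, ← map_sub]
  refine isVanishingOn_compl_dsupport (φ - ψ) fun x hx hxT => ?_
  refine notMem_tsupport_iff_eventuallyEq.2 ?_ hx
  filter_upwards [isOpen_thickening.mem_nhds (self_subset_thickening hδ _ (hT hxT))] with y hy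
  rw [sub_apply, h hy, sub_self, Pi.zero_apply]

end Support

section Exponentials

open scoped ContDiff
open Metric

variable {E : Type*} [NormedAddCommGroup E] [NormedSpace ℝ E]

/-- The Schwartz function `χ e^l`, for a compactly supported cutoff `χ` and a complex-valued
real-linear form `l`. When `χ` is `1` near the support of a distribution `T`, the value
`T (χ e^l)` stands for the action of `T` on the exponential `e^l`. -/
noncomputable def mulExp (χ : 𝓢(E, ℂ)) (hχ : HasCompactSupport χ) (l : E →L[ℝ] ℂ) : 𝓢(E, ℂ) :=
  (hχ.mul_right (f' := fun x => Complex.exp (l x))).toSchwartzMap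
    ((χ.smooth ⊤).mul l.contDiff.cexp)

variable (χ : 𝓢(E, ℂ)) (hχ : HasCompactSupport χ)

theorem mulExp_apply (l : E →L[ℝ] ℂ) (x : E) : mulExp χ hχ l x = χ x * Complex.exp (l x) := rfl

theorem tsupport_mulExp_subset (l : E →L[ℝ] ℂ) : tsupport (mulExp χ hχ l) ⊆ tsupport χ :=
  tsupport_mul_subset_left

theorem exists_clm_eq_apply_smulLeftCLM (T : 𝓢(E, ℂ) →L[ℂ] ℂ) (ψ : 𝓢(E, ℂ)) :
    ∃ D : (E →L[ℝ] ℂ) →L[ℂ] ℂ, ∀ m : E →L[ℝ] ℂ, D m = T (SchwartzMap.smulLeftCLM ℂ m ψ) := by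
  obtain ⟨C, M, -, hCM⟩ := exists_norm_apply_mul_le T ψ
  have hgrowth : ∀ m : E →L[ℝ] ℂ, Function.HasTemperateGrowth m := fun m => m.hasTemperateGrowth
  let D : (E →L[ℝ] ℂ) →ₗ[ℂ] ℂ :=
    { toFun := fun m => T (SchwartzMap.smulLeftCLM ℂ m ψ)
      map_add' := fun m n => by
        rw [← map_add, ← add_apply, ← SchwartzMap.smulLeftCLM_add (hgrowth m) (hgrowth n)]
        rfl
      map_smul' := fun c m => by
        rw [RingHom.id_apply, ← map_smul, ← smul_apply, ← SchwartzMap.smulLeftCLM_smul (hgrowth m)]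
        rfl }
  refine ⟨D.mkContinuous C fun m => hCM m ‖m‖ m.contDiff (norm_nonneg m)
    (fun x _ j _ => norm_iteratedFDeriv_clm_le m j x) _ fun x => ?_, fun _ => rfl⟩
  rw [SchwartzMap.smulLeftCLM_apply_apply (hgrowth m), smul_eq_mul, mul_comm]

theorem differentiable_apply_mulExp (T : 𝓢(E, ℂ) →L[ℂ] ℂ) :
    Differentiable ℂ fun l : E →L[ℝ] ℂ => T (mulExp χ hχ l) := by
  intro l
  set ψ := mulExp χ hχ l
  obtain ⟨C, M, _, hCM⟩ := exists_norm_apply_mul_le T ψ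
  obtain ⟨D, hD⟩ := exists_clm_eq_apply_smulLeftCLM T ψ
  obtain ⟨R, hR1, hR⟩ : ∃ R : ℝ, 1 ≤ R ∧ ∀ x ∈ tsupport ψ, ‖x‖ ≤ R := by
    obtain ⟨R, hR⟩ := hχ.isBounded.exists_norm_le
    exact ⟨max 1 R, le_max_left _ _, fun x hx =>
      (hR x (tsupport_mulExp_subset χ hχ l hx)).trans (le_max_right _ _)⟩
  refine HasFDerivAt.differentiableAt (f' := D) ?_
  rw [hasFDerivAt_iff_isLittleO_nhds_zero]
  refine Asymptotics.IsBigO.trans_isLittleO (g := fun m : E →L[ℝ] ℂ => ‖m‖ ^ 2)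
    (Asymptotics.IsBigO.of_bound (C * (3 * R ^ 2)) ?_)
    (Asymptotics.isLittleO_norm_pow_id one_lt_two)
  filter_upwards [closedBall_mem_nhds (0 : E →L[ℝ] ℂ) (inv_pos.2 (one_pos.trans_le hR1))] with m hm
  have hmR : ‖m‖ * R ≤ 1 :=
    (le_div_iff₀ (by positivity)).1 (by simpa using hm)
  rw [hD, ← map_sub, ← map_sub, norm_pow, norm_norm, mul_assoc]
  refine hCM (fun x => Complex.exp (m x) - 1 - m x) _
    ((m.contDiff.cexp.sub contDiff_const).sub m.contDiff) (by positivity)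
    (fun x hx j _ => (norm_iteratedFDeriv_cexp_clm_sub_one_sub_le hR1 hmR j (hR x hx)).trans
      (le_mul_of_one_le_right (by positivity) (by linarith [norm_nonneg x]))) _ fun x => ?_
  rw [sub_apply, sub_apply, SchwartzMap.smulLeftCLM_apply_apply m.hasTemperateGrowth,
    smul_eq_mul, mulExp_apply, mulExp_apply, add_apply, Complex.exp_add]
  ring

end Exponentials

section FourierLaplace

variable {d : ℕ}

/-- The real-linear form `x ↦ -i z·x` on `ℝ^d`, as a complex-linear function of `z ∈ ℂ^d`. -/
noncomputable def fourierForm (d : ℕ) :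
    EuclideanSpace ℂ (Fin d) →L[ℂ] EuclideanSpace ℝ (Fin d) →L[ℝ] ℂ :=
  ∑ j, (EuclideanSpace.proj j : EuclideanSpace ℂ (Fin d) →L[ℂ] ℂ).smulRight
    (-Complex.I • Complex.ofRealCLM.comp (EuclideanSpace.proj j))

theorem fourierForm_apply (z : EuclideanSpace ℂ (Fin d)) (x : EuclideanSpace ℝ (Fin d)) :
    fourierForm d z x = -Complex.I * ∑ j, z j * (x j : ℂ) := by
  simp [fourierForm, Finset.mul_sum, mul_left_comm]

theorem fourierForm_apply_re (z : EuclideanSpace ℂ (Fin d)) (x : EuclideanSpace ℝ (Fin d)) :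
    (fourierForm d z x).re = ⟪x, imPart z⟫ := by
  simp [fourierForm_apply, PiLp.inner_apply, imPart]

theorem fourierForm_realToComplex (ξ x : EuclideanSpace ℝ (Fin d)) :
    fourierForm d (realToComplex ξ) x = -Complex.I * (⟪ξ, x⟫ : ℝ) := by
  simp [fourierForm_apply, PiLp.inner_apply, realToComplex, mul_comm]

theorem norm_realToComplex (x : EuclideanSpace ℝ (Fin d)) : ‖realToComplex x‖ = ‖x‖ := by
  simp [EuclideanSpace.norm_eq, realToComplex]

theorem norm_imPart_le (z : EuclideanSpace ℂ (Fin d)) : ‖imPart z‖ ≤ ‖z‖ := by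
  rw [EuclideanSpace.norm_eq, EuclideanSpace.norm_eq]
  refine Real.sqrt_le_sqrt (Finset.sum_le_sum fun j _ => ?_)
  gcongr
  exact Complex.abs_im_le_norm (z j)

theorem norm_fourierForm_le (z : EuclideanSpace ℂ (Fin d)) : ‖fourierForm d z‖ ≤ ‖z‖ := by
  refine ContinuousLinearMap.opNorm_le_bound _ (norm_nonneg z) fun x => ?_
  have hinner : ∑ j, z j * (x j : ℂ) = inner ℂ (realToComplex x) z := by
    simp [PiLp.inner_apply, realToComplex]
  rw [fourierForm_apply, hinner, norm_mul, norm_neg, Complex.norm_I, one_mul, mul_comm,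
    ← norm_realToComplex x]
  exact norm_inner_le_norm _ _

/-- The Fourier–Laplace transform `z ↦ (2π)^{-d/2} T(χ e^{-i z·x})` of `T`, localized by a compactly
supported cutoff `χ`. -/
noncomputable def fourierLaplace (T : 𝓢(EuclideanSpace ℝ (Fin d), ℂ) →L[ℂ] ℂ)
    (χ : 𝓢(EuclideanSpace ℝ (Fin d), ℂ)) (hχ : HasCompactSupport χ)
    (z : EuclideanSpace ℂ (Fin d)) : ℂ :=
  ((((2 * Real.pi) ^ ((d : ℝ) / 2))⁻¹ : ℝ) : ℂ) * T (mulExp χ hχ (fourierForm d z))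

theorem differentiable_fourierLaplace (T : 𝓢(EuclideanSpace ℝ (Fin d), ℂ) →L[ℂ] ℂ)
    (χ : 𝓢(EuclideanSpace ℝ (Fin d), ℂ)) (hχ : HasCompactSupport χ) :
    Differentiable ℂ (fourierLaplace T χ hχ) :=
  ((differentiable_apply_mulExp χ hχ T).comp (fourierForm d).differentiable).const_mul _

end FourierLaplace

section SupportingFunction

variable {d : ℕ}

theorem inner_le_supportingFunction {A : Set (EuclideanSpace ℝ (Fin d))} (hA : IsCompact A)
    {a : EuclideanSpace ℝ (Fin d)} (ha : a ∈ A) (y : EuclideanSpace ℝ (Fin d)) :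
    ⟪a, y⟫ ≤ supportingFunction A y :=
  le_csSup (hA.image (by fun_prop)).bddAbove ⟨a, ha, rfl⟩

theorem inner_le_of_mem_thickening {A : Set (EuclideanSpace ℝ (Fin d))} (hA : IsCompact A)
    {δ : ℝ} {x : EuclideanSpace ℝ (Fin d)} (hx : x ∈ Metric.thickening δ A)
    (y : EuclideanSpace ℝ (Fin d)) : ⟪x, y⟫ ≤ supportingFunction A y + δ * ‖y‖ := by
  obtain ⟨a, ha, hxa⟩ := Metric.mem_thickening_iff.1 hx
  rw [dist_eq_norm] at hxa
  calc ⟪x, y⟫ = ⟪a, y⟫ + ⟪x - a, y⟫ := by rw [← inner_add_left, add_sub_cancel]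
    _ ≤ supportingFunction A y + ‖x - a‖ * ‖y‖ :=
      add_le_add (inner_le_supportingFunction hA ha y) (real_inner_le_norm _ _)
    _ ≤ supportingFunction A y + δ * ‖y‖ := by gcongr

end SupportingFunction

section Representation

open scoped ContDiff
open Metric Distribution Filter Topology

theorem exists_schwartz_integral_eq_one (E : Type*) [NormedAddCommGroup E] [NormedSpace ℝ E]
    [FiniteDimensional ℝ E] [MeasurableSpace E] [BorelSpace E] (μ : Measure E)
    [IsLocallyFiniteMeasure μ] [μ.IsOpenPosMeasure] :
    ∃ ρ : 𝓢(E, ℂ), HasCompactSupport ρ ∧ ∫ x, ρ x ∂μ = 1 := by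
  let b : ContDiffBump (0 : E) := ⟨1, 2, one_pos, one_lt_two⟩
  have hc : HasCompactSupport fun x => (b.normed μ x : ℂ) :=
    b.hasCompactSupport_normed.comp_left (g := Complex.ofReal) rfl
  refine ⟨hc.toSchwartzMap (Complex.ofRealCLM.contDiff.comp b.contDiff_normed), hc, ?_⟩
  change ∫ x, (b.normed μ x : ℂ) ∂μ = 1
  rw [integral_complex_ofReal, b.integral_normed, Complex.ofReal_one]

theorem exists_schwartz_dilation {E : Type*} [NormedAddCommGroup E] [NormedSpace ℝ E]
    {ρ : 𝓢(E, ℂ)} (hρ : HasCompactSupport ρ) (ξ : E) {ε : ℝ} (hε : ε ≠ 0) :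
    ∃ φ : 𝓢(E, ℂ), ∀ u, φ (ξ + ε • u) = ρ u := by
  have hc : HasCompactSupport fun x => ρ (ε⁻¹ • (x - ξ)) :=
    (hρ.comp_smul (inv_ne_zero hε)).comp_homeomorph (Homeomorph.subRight ξ)
  refine ⟨hc.toSchwartzMap ((ρ.smooth ⊤).comp (by fun_prop)), fun u => ?_⟩
  change ρ (ε⁻¹ • (ξ + ε • u - ξ)) = ρ u
  rw [add_sub_cancel_left, inv_smul_smul₀ hε]

theorem tendsto_integral_mul_dilation {E : Type*} [NormedAddCommGroup E] [NormedSpace ℝ E]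
    [MeasurableSpace E] [BorelSpace E] (μ : Measure E) [IsLocallyFiniteMeasure μ]
    {f ρ : E → ℂ} (hf : Continuous f) (hρ : Continuous ρ) (hρc : HasCompactSupport ρ) (ξ : E) :
    Tendsto (fun ε : ℝ => ∫ u, f (ξ + ε • u) * ρ u ∂μ) (𝓝 0) (𝓝 (f ξ * ∫ u, ρ u ∂μ)) := by
  have hset : ∀ ε : ℝ, ∫ u in tsupport ρ, f (ξ + ε • u) * ρ u ∂μ = ∫ u, f (ξ + ε • u) * ρ u ∂μ :=
    fun ε => setIntegral_eq_integral_of_forall_compl_eq_zero fun u hu => by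
      rw [image_eq_zero_of_notMem_tsupport hu, mul_zero]
  have hcont : Continuous fun ε : ℝ => ∫ u, f (ξ + ε • u) * ρ u ∂μ := by
    simp only [← hset]
    exact continuous_parametric_integral_of_continuous
      ((hf.comp (by fun_prop)).mul (hρ.comp continuous_snd)) hρc
  refine hcont.tendsto' 0 _ ?_
  simp only [zero_smul, add_zero, integral_const_mul]

variable {d : ℕ}

theorem integral_eq_pow_smul_integral_dilation {F : Type*} [NormedAddCommGroup F] [NormedSpace ℝ F]
    (k : EuclideanSpace ℝ (Fin d) → F) (ξ : EuclideanSpace ℝ (Fin d)) {ε : ℝ} (hε : 0 < ε) :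
    ∫ x, k x = ε ^ d • ∫ u, k (ξ + ε • u) := by
  rw [Measure.integral_comp_smul volume (fun x => k (ξ + x)) ε, integral_add_left_eq_self k ξ,
    finrank_euclideanSpace_fin, abs_of_pos (by positivity), smul_inv_smul₀ (by positivity)]

theorem fourierSchwartz_zero_apply (φ : 𝓢(EuclideanSpace ℝ (Fin d), ℂ)) :
    fourierSchwartz d φ 0 = ((((2 * Real.pi) ^ ((d : ℝ) / 2))⁻¹ : ℝ) : ℂ) * ∫ x, φ x := by
  simp [fourierSchwartz_apply]

theorem fourierSchwartz_dilation {φ ρ : 𝓢(EuclideanSpace ℝ (Fin d), ℂ)}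
    {ξ : EuclideanSpace ℝ (Fin d)} {ε : ℝ} (hε : 0 < ε) (hφ : ∀ u, φ (ξ + ε • u) = ρ u)
    (x : EuclideanSpace ℝ (Fin d)) :
    fourierSchwartz d φ x = (ε : ℂ) ^ d *
      (Complex.exp (fourierForm d (realToComplex ξ) x) * fourierSchwartz d ρ (ε • x)) := by
  have hexp : ∀ u, ρ u * Complex.exp (-Complex.I * (⟪x, ξ + ε • u⟫ : ℝ)) =
      Complex.exp (fourierForm d (realToComplex ξ) x) *
        (ρ u * Complex.exp (-Complex.I * (⟪ε • x, u⟫ : ℝ))) := fun u => by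
    rw [mul_left_comm, ← Complex.exp_add, fourierForm_realToComplex, inner_add_right,
      inner_smul_right, real_inner_smul_left, real_inner_comm, ← mul_add, Complex.ofReal_add]
  rw [fourierSchwartz_apply, fourierSchwartz_apply, integral_eq_pow_smul_integral_dilation _ ξ hε]
  simp only [hφ, hexp, integral_const_mul, Complex.real_smul, Complex.ofReal_pow]
  ring

theorem IsFourierTransformOf.integral_mul_dilation {f : EuclideanSpace ℝ (Fin d) → ℂ}
    {T : 𝓢'(EuclideanSpace ℝ (Fin d), ℂ)} (hf : IsFourierTransformOf f T)
    {A : Set (EuclideanSpace ℝ (Fin d))} (hT : dsupport T ⊆ A)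
    (χ : 𝓢(EuclideanSpace ℝ (Fin d), ℂ)) (hχ : HasCompactSupport χ) {δ : ℝ} (hδ : 0 < δ)
    (hone : ∀ x ∈ thickening δ A, χ x = 1) {ρ : 𝓢(EuclideanSpace ℝ (Fin d), ℂ)}
    (hρ : HasCompactSupport ρ) (ξ : EuclideanSpace ℝ (Fin d)) {ε : ℝ} (hε : 0 < ε) :
    ∫ u, f (ξ + ε • u) * ρ u =
      T (SchwartzMap.smulLeftCLM ℂ (fun x => fourierSchwartz d ρ (ε • x))
        (mulExp χ hχ (fourierForm d (realToComplex ξ)))) := by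
  obtain ⟨φ, hφ⟩ := exists_schwartz_dilation hρ ξ hε.ne'
  have hε0 : (ε : ℂ) ^ d ≠ 0 := pow_ne_zero _ (Complex.ofReal_ne_zero.2 hε.ne')
  set ψ := SchwartzMap.smulLeftCLM ℂ (fun x => fourierSchwartz d ρ (ε • x))
    (mulExp χ hχ (fourierForm d (realToComplex ξ)))
  have hψ : Set.EqOn (fourierSchwartz d φ) ((ε : ℂ) ^ d • ψ : 𝓢(_, ℂ)) (thickening δ A) :=
    fun x hx => by
      rw [smul_apply, SchwartzMap.smulLeftCLM_apply_apply (hasTemperateGrowth_dilation _ ε),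
        mulExp_apply, hone x hx, fourierSchwartz_dilation hε hφ, smul_eq_mul, smul_eq_mul, one_mul,
        mul_comm (Complex.exp _)]
  refine mul_left_cancel₀ hε0 ?_
  calc (ε : ℂ) ^ d * ∫ u, f (ξ + ε • u) * ρ u = ∫ x, f x * φ x := by
        rw [integral_eq_pow_smul_integral_dilation (fun x => f x * φ x) ξ hε, Complex.real_smul,
          Complex.ofReal_pow]
        simp only [hφ]
    _ = T (fourierSchwartz d φ) := by rw [← (hf.2 φ).2, fourierTempered_apply]
    _ = T ((ε : ℂ) ^ d • ψ) :=
        apply_congr_of_eqOn_thickening (T := (T : 𝓢(_, ℂ) →L[ℂ] ℂ)) hT hδ hψ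
    _ = (ε : ℂ) ^ d * T ψ := by rw [map_smul, smul_eq_mul]

theorem IsFourierTransformOf.eq_fourierLaplace {f : EuclideanSpace ℝ (Fin d) → ℂ}
    {T : 𝓢'(EuclideanSpace ℝ (Fin d), ℂ)} (hf : IsFourierTransformOf f T)
    {A : Set (EuclideanSpace ℝ (Fin d))} (hT : dsupport T ⊆ A)
    (χ : 𝓢(EuclideanSpace ℝ (Fin d), ℂ)) (hχ : HasCompactSupport χ) {δ : ℝ} (hδ : 0 < δ)
    (hone : ∀ x ∈ thickening δ A, χ x = 1) (ξ : EuclideanSpace ℝ (Fin d)) :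
    f ξ = fourierLaplace T χ hχ (realToComplex ξ) := by
  obtain ⟨ρ, hρ, hρ1⟩ := exists_schwartz_integral_eq_one (EuclideanSpace ℝ (Fin d)) volume
  have hleft := (tendsto_integral_mul_dilation volume hf.1 ρ.continuous hρ ξ).mono_left
    (nhdsWithin_le_nhds (s := Set.Ioi 0))
  have hright := (tendsto_apply_smulLeftCLM_dilation T
    (mulExp χ hχ (fourierForm d (realToComplex ξ))) (fourierSchwartz d ρ)).mono_left
    (nhdsWithin_le_nhds (s := Set.Ioi 0))
  rw [hρ1, mul_one] at hleft
  rw [fourierSchwartz_zero_apply, hρ1, mul_one] at hright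
  refine tendsto_nhds_unique (hleft.congr' ?_) hright
  filter_upwards [self_mem_nhdsWithin] with ε hε
  exact hf.integral_mul_dilation hT χ hχ hδ hone hρ ξ hε

end Representation

section Order

open scoped ContDiff
open Metric Distribution

theorem seminorm_mulExp_le {E : Type*} [NormedAddCommGroup E] [NormedSpace ℝ E] (χ : 𝓢(E, ℂ))
    (hχ : HasCompactSupport χ) (l : E →L[ℝ] ℂ) {D : ℕ → ℝ} {r S : ℝ}
    (hD : ∀ i x, ‖iteratedFDeriv ℝ i χ x‖ ≤ D i * r ^ i) (hl : ‖l‖ ≤ r)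
    (hS : ∀ x ∈ tsupport χ, (l x).re ≤ S) (k : ℕ) :
    SchwartzMap.seminorm ℂ 0 k (mulExp χ hχ l) ≤
      (∑ i ∈ Finset.range (k + 1), (k.choose i : ℝ) * D i) * (r ^ k * Real.exp S) := by
  have hr : 0 ≤ r := (norm_nonneg l).trans hl
  have hDr : ∀ i, 0 ≤ D i * r ^ i := fun i => (norm_nonneg _).trans (hD i 0)
  have hsum : (∑ i ∈ Finset.range (k + 1), (k.choose i : ℝ) * D i) * (r ^ k * Real.exp S) =
      ∑ i ∈ Finset.range (k + 1), (k.choose i : ℝ) * (D i * r ^ i) *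
        (r ^ (k - i) * Real.exp S) := by
    rw [Finset.sum_mul]
    refine Finset.sum_congr rfl fun i hi => ?_
    rw [← pow_mul_pow_sub r (Nat.lt_succ_iff.1 (Finset.mem_range.1 hi))]
    ring
  rw [hsum]
  have hnonneg : 0 ≤ ∑ i ∈ Finset.range (k + 1), (k.choose i : ℝ) * (D i * r ^ i) *
      (r ^ (k - i) * Real.exp S) :=
    Finset.sum_nonneg fun i _ => mul_nonneg (mul_nonneg (by positivity) (hDr i)) (by positivity)
  refine SchwartzMap.seminorm_le_bound ℂ 0 k _ hnonneg fun x => ?_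
  rw [pow_zero, one_mul]
  by_cases hx : x ∈ tsupport χ
  · refine (norm_iteratedFDeriv_mul_le (χ.smooth ⊤) l.contDiff.cexp x (mod_cast le_top)).trans ?_
    gcongr with i
    · exact mul_nonneg (by positivity) (hDr i)
    · exact hD i x
    · refine (norm_iteratedFDeriv_cexp_clm_le l _ x).trans ?_
      gcongr
      exact hS x hx
  · rwa [image_eq_zero_of_notMem_tsupport fun hx' =>
      hx (tsupport_mulExp_subset χ hχ l (tsupport_iteratedFDeriv_subset k hx')), norm_zero]

variable {d : ℕ} {T : 𝓢'(EuclideanSpace ℝ (Fin d), ℂ)} {A : Set (EuclideanSpace ℝ (Fin d))}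

theorem exists_hasOrderAtMost (T : 𝓢'(EuclideanSpace ℝ (Fin d), ℂ)) :
    ∃ N, HasOrderAtMost T N := by
  obtain ⟨s, C, hC, hs⟩ := exists_norm_apply_le_finset_sup (T : 𝓢(_, ℂ) →L[ℂ] ℂ)
  refine ⟨s.sup Prod.snd, fun K hK => ?_⟩
  obtain ⟨R, hR0, hR⟩ : ∃ R : ℝ, 0 ≤ R ∧ ∀ x ∈ K, ‖x‖ ≤ R := by
    obtain ⟨R, hR⟩ := hK.isBounded.exists_norm_le
    exact ⟨max 0 R, le_max_left _ _, fun x hx => (hR x hx).trans (le_max_right _ _)⟩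
  refine ⟨C * ∑ p ∈ s, R ^ p.1, fun φ hφ => (hs φ).trans ?_⟩
  rw [mul_assoc]
  gcongr
  refine Seminorm.finset_sup_apply_le (by positivity) fun p hp => ?_
  have hweight : SchwartzMap.seminorm ℂ p.1 p.2 φ ≤
      R ^ p.1 * SchwartzMap.seminorm ℂ 0 p.2 φ := by
    refine SchwartzMap.seminorm_le_bound ℂ p.1 p.2 φ (by positivity) fun x => ?_
    by_cases hx : x ∈ tsupport φ
    · gcongr
      · exact hR x (hφ hx)
      · exact SchwartzMap.norm_iteratedFDeriv_le_seminorm ℂ φ p.2 x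
    · rw [image_eq_zero_of_notMem_tsupport fun hx' => hx (tsupport_iteratedFDeriv_subset p.2 hx'),
        norm_zero, mul_zero]
      positivity
  refine hweight.trans (mul_le_mul ?_ ?_ (by positivity) (by positivity))
  · exact Finset.single_le_sum (f := fun p : ℕ × ℕ => R ^ p.1) (fun _ _ => by positivity) hp
  · exact Finset.single_le_sum (f := fun n => SchwartzMap.seminorm ℂ 0 n φ)
      (fun _ _ => by positivity) (Finset.mem_range_succ_iff.2 (Finset.le_sup (f := Prod.snd) hp))

theorem exists_hasOrder (T : 𝓢'(EuclideanSpace ℝ (Fin d), ℂ)) : ∃ N, HasOrder T N :=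
  have hne : {n : ℕ | HasOrderAtMost T n}.Nonempty := exists_hasOrderAtMost T
  ⟨_, Nat.sInf_mem hne, fun _ => Nat.sInf_le⟩

theorem apply_mulExp_congr {E : Type*} [NormedAddCommGroup E] [NormedSpace ℝ E]
    [FiniteDimensional ℝ E] {T : 𝓢(E, ℂ) →L[ℂ] ℂ} {A : Set E} (hT : dsupport T ⊆ A)
    {χ₁ χ₂ : 𝓢(E, ℂ)} (hχ₁ : HasCompactSupport χ₁) (hχ₂ : HasCompactSupport χ₂) {δ₁ δ₂ : ℝ}
    (hδ₁ : 0 < δ₁) (hδ₂ : 0 < δ₂) (hone₁ : ∀ x ∈ thickening δ₁ A, χ₁ x = 1)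
    (hone₂ : ∀ x ∈ thickening δ₂ A, χ₂ x = 1) (l : E →L[ℝ] ℂ) :
    T (mulExp χ₁ hχ₁ l) = T (mulExp χ₂ hχ₂ l) :=
  apply_congr_of_eqOn_thickening hT (lt_min hδ₁ hδ₂) fun x hx => by
    rw [mulExp_apply, mulExp_apply, hone₁ x (thickening_mono (min_le_left _ _) _ hx),
      hone₂ x (thickening_mono (min_le_right _ _) _ hx)]

theorem fourierForm_apply_re_le (hA : IsCompact A) (z : EuclideanSpace ℂ (Fin d))
    {x : EuclideanSpace ℝ (Fin d)} (hx : x ∈ cthickening (1 + ‖z‖)⁻¹ A) :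
    (fourierForm d z x).re ≤ supportingFunction A (imPart z) + 2 := by
  have hx2 : x ∈ thickening (2 * (1 + ‖z‖)⁻¹) A :=
    cthickening_subset_thickening' (by positivity) (lt_two_mul_self (by positivity)) _ hx
  have hscale : (1 + ‖z‖)⁻¹ * ‖imPart z‖ ≤ 1 := by
    rw [inv_mul_le_one₀ (by positivity)]
    linarith [norm_imPart_le z]
  rw [fourierForm_apply_re]
  linarith [inner_le_of_mem_thickening hA hx2 (imPart z)]

-- Cutting off at distance `(1 + ‖z‖)⁻¹` from `A` costs one power of `1 + ‖z‖` per derivative and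
-- enlarges `e^{H_A(Im z)}` only by a constant factor.
theorem HasOrderAtMost.exists_norm_apply_mulExp_le {N : ℕ} (hN : HasOrderAtMost T N)
    (hA : IsCompact A) : ∃ C : ℝ, ∀ z, ∃ (χ : 𝓢(EuclideanSpace ℝ (Fin d), ℂ))
      (hχ : HasCompactSupport χ), (∃ δ > 0, ∀ x ∈ thickening δ A, χ x = 1) ∧
        ‖T (mulExp χ hχ (fourierForm d z))‖ ≤
          C * (1 + ‖z‖) ^ N * Real.exp (supportingFunction A (imPart z)) := by
  obtain ⟨C, hC⟩ := hN (cthickening 1 A) hA.cthickening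
  obtain ⟨D, hD⟩ := exists_schwartz_cutoff_of_scale hA
  set B : ℝ := ∑ k ∈ Finset.range (N + 1), |∑ i ∈ Finset.range (k + 1), (k.choose i : ℝ) * D i|
  refine ⟨|C| * B * Real.exp 2, fun z => ?_⟩
  have hz : 1 ≤ 1 + ‖z‖ := le_add_of_nonneg_right (norm_nonneg z)
  obtain ⟨χ, hχ, hsub, hone, hbound⟩ := hD (1 + ‖z‖)⁻¹ (by positivity)
  rw [inv_inv] at hbound
  refine ⟨χ, hχ, ⟨(1 + ‖z‖)⁻¹ / 4, by positivity, hone⟩, ?_⟩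
  set φ := mulExp χ hχ (fourierForm d z)
  set S := supportingFunction A (imPart z)
  have hφ : tsupport φ ⊆ cthickening 1 A := (tsupport_mulExp_subset _ _ _).trans
    (hsub.trans (cthickening_mono (inv_le_one_of_one_le₀ hz) _))
  have hseminorm : ∀ k ∈ Finset.range (N + 1), SchwartzMap.seminorm ℂ 0 k φ ≤
      |∑ i ∈ Finset.range (k + 1), (k.choose i : ℝ) * D i| *
        ((1 + ‖z‖) ^ N * Real.exp (S + 2)) := fun k hk =>
    (seminorm_mulExp_le χ hχ (fourierForm d z) hbound
      ((norm_fourierForm_le z).trans (by linarith))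
      (fun x hx => fourierForm_apply_re_le hA z (hsub hx)) k).trans <| by
        gcongr
        · exact le_abs_self _
        · exact Finset.mem_range_succ_iff.1 hk
  calc ‖T φ‖ ≤ |C| * ∑ k ∈ Finset.range (N + 1), SchwartzMap.seminorm ℂ 0 k φ :=
        (hC φ hφ).trans (by gcongr; exact le_abs_self C)
    _ ≤ |C| * (B * ((1 + ‖z‖) ^ N * Real.exp (S + 2))) := by
        rw [Finset.sum_mul]
        gcongr with k hk
        exact hseminorm k hk
    _ = |C| * B * Real.exp 2 * (1 + ‖z‖) ^ N * Real.exp S := by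
        rw [Real.exp_add]
        ring

theorem HasOrderAtMost.exists_norm_fourierLaplace_le {N : ℕ} (hN : HasOrderAtMost T N)
    (hA : IsCompact A) (hT : dsupport T ⊆ A) {χ : 𝓢(EuclideanSpace ℝ (Fin d), ℂ)}
    (hχ : HasCompactSupport χ) {δ : ℝ} (hδ : 0 < δ) (hone : ∀ x ∈ thickening δ A, χ x = 1) :
    ∃ C : ℝ, ∀ z, ‖fourierLaplace T χ hχ z‖ ≤
      C * (1 + ‖z‖) ^ N * Real.exp (supportingFunction A (imPart z)) := by
  obtain ⟨C, hC⟩ := hN.exists_norm_apply_mulExp_le hA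
  set c : ℂ := ((((2 * Real.pi) ^ ((d : ℝ) / 2))⁻¹ : ℝ) : ℂ)
  refine ⟨‖c‖ * C, fun z => ?_⟩
  obtain ⟨χ', hχ', ⟨δ', hδ', hone'⟩, hbound⟩ := hC z
  have hcongr : T (mulExp χ hχ (fourierForm d z)) = T (mulExp χ' hχ' (fourierForm d z)) :=
    apply_mulExp_congr (T := (T : 𝓢(_, ℂ) →L[ℂ] ℂ)) hT hχ hχ' hδ hδ' hone hone' _
  calc ‖fourierLaplace T χ hχ z‖ = ‖c‖ * ‖T (mulExp χ' hχ' (fourierForm d z))‖ := by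
        rw [← hcongr, ← norm_mul]
        rfl
    _ ≤ ‖c‖ * (C * (1 + ‖z‖) ^ N * Real.exp (supportingFunction A (imPart z))) := by gcongr
    _ = ‖c‖ * C * (1 + ‖z‖) ^ N * Real.exp (supportingFunction A (imPart z)) := by ring

theorem IsFourierTransformOf.extendsEntireWithBound {f : EuclideanSpace ℝ (Fin d) → ℂ}
    (hf : IsFourierTransformOf f T) (hA : IsCompact A) (hT : dsupport T ⊆ A) {N : ℕ}
    (hN : HasOrderAtMost T N) : ExtendsEntireWithBound A f N := by
  obtain ⟨χ, hχ, -, δ, hδ, hone⟩ := exists_schwartz_cutoff hA isOpen_univ (Set.subset_univ _)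
  exact ⟨fourierLaplace T χ hχ, differentiable_fourierLaplace _ χ hχ,
    fun x => (hf.eq_fourierLaplace hT χ hχ hδ hone x).symm,
    hN.exists_norm_fourierLaplace_le hA hT hχ hδ hone⟩

end Order

section FourierInverse

variable {d : ℕ}

/-- The inverse of the Fourier transform `fourierSchwartz`, obtained by undoing its rescaling. -/
noncomputable def fourierSchwartzInv (d : ℕ) :
    𝓢(EuclideanSpace ℝ (Fin d), ℂ) →L[ℂ] 𝓢(EuclideanSpace ℝ (Fin d), ℂ) :=
  (((2 * Real.pi) ^ ((d : ℝ) / 2) : ℝ) : ℂ) •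
    ((FourierTransform.fourierInvCLM ℂ 𝓢(EuclideanSpace ℝ (Fin d), ℂ)).comp
      (SchwartzMap.compCLMOfContinuousLinearEquiv ℂ
        (ContinuousLinearEquiv.smulLeft (Units.mk0 (2 * Real.pi) Real.two_pi_pos.ne'))))

theorem fourierSchwartzInv_fourierSchwartz (φ : 𝓢(EuclideanSpace ℝ (Fin d), ℂ)) :
    fourierSchwartzInv d (fourierSchwartz d φ) = φ := by
  have hc : (((2 * Real.pi) ^ ((d : ℝ) / 2) : ℝ) : ℂ) ≠ 0 :=
    Complex.ofReal_ne_zero.2 (Real.rpow_pos_of_pos Real.two_pi_pos _).ne'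
  have hdilation : SchwartzMap.compCLMOfContinuousLinearEquiv ℂ
      (ContinuousLinearEquiv.smulLeft (Units.mk0 (2 * Real.pi) Real.two_pi_pos.ne'))
      (SchwartzMap.compCLMOfContinuousLinearEquiv ℂ (ContinuousLinearEquiv.smulLeft
        (Units.mk0 ((2 * Real.pi)⁻¹ : ℝ) (inv_ne_zero Real.two_pi_pos.ne'))) (𝓕 φ)) = 𝓕 φ :=
    SchwartzMap.ext fun x => congrArg (𝓕 φ : 𝓢(_, ℂ)) (inv_smul_smul₀ Real.two_pi_pos.ne' x)
  simp only [fourierSchwartzInv, fourierSchwartz, smul_apply, map_smul,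
    ContinuousLinearMap.comp_apply, FourierTransform.fourierCLM_apply, hdilation,
    FourierTransform.fourierInvCLM_apply, FourierTransform.fourierInv_fourier_eq]
  rw [smul_smul, Complex.ofReal_inv, inv_mul_cancel₀ hc, one_smul]

theorem fourierSchwartz_fourierSchwartzInv (φ : 𝓢(EuclideanSpace ℝ (Fin d), ℂ)) :
    fourierSchwartz d (fourierSchwartzInv d φ) = φ := by
  have hc : (((2 * Real.pi) ^ ((d : ℝ) / 2) : ℝ) : ℂ) ≠ 0 :=
    Complex.ofReal_ne_zero.2 (Real.rpow_pos_of_pos Real.two_pi_pos _).ne'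
  have hdilation : SchwartzMap.compCLMOfContinuousLinearEquiv ℂ (ContinuousLinearEquiv.smulLeft
        (Units.mk0 ((2 * Real.pi)⁻¹ : ℝ) (inv_ne_zero Real.two_pi_pos.ne')))
      (SchwartzMap.compCLMOfContinuousLinearEquiv ℂ
        (ContinuousLinearEquiv.smulLeft (Units.mk0 (2 * Real.pi) Real.two_pi_pos.ne')) φ) = φ :=
    SchwartzMap.ext fun x => congrArg φ (smul_inv_smul₀ Real.two_pi_pos.ne' x)
  simp only [fourierSchwartzInv, fourierSchwartz, smul_apply, map_smul,
    ContinuousLinearMap.comp_apply, FourierTransform.fourierCLM_apply,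
    FourierTransform.fourierInvCLM_apply, FourierTransform.fourier_fourierInv_eq, hdilation]
  rw [smul_smul, Complex.ofReal_inv, mul_inv_cancel₀ hc, one_smul]

theorem fourierSchwartzInv_apply (φ : 𝓢(EuclideanSpace ℝ (Fin d), ℂ))
    (ξ : EuclideanSpace ℝ (Fin d)) : fourierSchwartzInv d φ ξ = fourierSchwartz d φ (-ξ) := by
  have hinv : fourierSchwartzInv d φ ξ = (((2 * Real.pi) ^ ((d : ℝ) / 2) : ℝ) : ℂ) *
      𝓕⁻ (fun x : EuclideanSpace ℝ (Fin d) => φ ((2 * Real.pi) • x)) ξ := by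
    change _ * 𝓕⁻ (SchwartzMap.compCLMOfContinuousLinearEquiv ℂ
      (ContinuousLinearEquiv.smulLeft (Units.mk0 (2 * Real.pi) Real.two_pi_pos.ne')) φ) ξ = _
    rw [SchwartzMap.fourierInv_coe]
    rfl
  have hconst : (2 * Real.pi) ^ ((d : ℝ) / 2) * |((2 * Real.pi) ^ d)⁻¹| =
      ((2 * Real.pi) ^ ((d : ℝ) / 2))⁻¹ := by
    have hpow : (2 * Real.pi) ^ d =
        (2 * Real.pi) ^ ((d : ℝ) / 2) * (2 * Real.pi) ^ ((d : ℝ) / 2) := by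
      rw [← Real.rpow_add Real.two_pi_pos, add_halves, Real.rpow_natCast]
    have := Real.rpow_pos_of_pos Real.two_pi_pos ((d : ℝ) / 2)
    rw [abs_of_pos (by positivity), hpow]
    field_simp
  have hscale := Measure.integral_comp_smul volume
    (fun x : EuclideanSpace ℝ (Fin d) => φ x * Complex.exp (-Complex.I * (⟪-ξ, x⟫ : ℝ)))
    (2 * Real.pi)
  rw [finrank_euclideanSpace_fin, Complex.real_smul] at hscale
  rw [hinv, fourierSchwartz_apply, ← hconst, Complex.ofReal_mul, mul_assoc, ← hscale,
    Real.fourierInv_eq']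
  congr 2 with x
  rw [smul_eq_mul, mul_comm, inner_neg_left, inner_smul_right, real_inner_comm,
    Complex.ofReal_neg, neg_mul_neg, mul_comm Complex.I]

theorem fourierSchwartz_eq_fourierLaplace (φ : 𝓢(EuclideanSpace ℝ (Fin d), ℂ))
    (hφ : HasCompactSupport φ) (ξ : EuclideanSpace ℝ (Fin d)) :
    fourierSchwartz d φ ξ =
      fourierLaplace (SchwartzMap.integralCLM ℂ volume) φ hφ (realToComplex ξ) := by
  simp only [fourierSchwartz_apply, fourierLaplace, SchwartzMap.integralCLM_apply, mulExp_apply,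
    fourierForm_realToComplex]

end FourierInverse

section TestFunctions

open scoped LineDeriv

theorem hasCompactSupport_lineDerivOp {E : Type*} [NormedAddCommGroup E] [NormedSpace ℝ E]
    {φ : 𝓢(E, ℂ)} (hφ : HasCompactSupport φ) (v : E) :
    HasCompactSupport (∂_{v} φ : 𝓢(E, ℂ)) :=
  hφ.of_isClosed_subset (isClosed_tsupport _) (SchwartzMap.tsupport_lineDerivOp_subset v φ)

theorem integral_mulExp_lineDerivOp {E : Type*} [NormedAddCommGroup E] [NormedSpace ℝ E]
    [FiniteDimensional ℝ E] [MeasurableSpace E] [BorelSpace E] (μ : Measure E)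
    [μ.IsAddHaarMeasure] (φ : 𝓢(E, ℂ)) (hφ : HasCompactSupport φ) (l : E →L[ℝ] ℂ) (v : E) :
    ∫ x, mulExp (∂_{v} φ) (hasCompactSupport_lineDerivOp hφ v) l x ∂μ =
      -l v * ∫ x, mulExp φ hφ l x ∂μ := by
  have hexp : ∀ x, φ x * fderiv ℝ (fun x => Complex.exp (l x)) x v = l v * mulExp φ hφ l x :=
    fun x => by
      rw [l.hasFDerivAt.cexp.fderiv, smul_apply, smul_eq_mul, mulExp_apply]
      ring
  have hparts := integral_mul_fderiv_eq_neg_fderiv_mul_of_integrable (μ := μ) (v := v)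
    (mulExp (∂_{v} φ) (hasCompactSupport_lineDerivOp hφ v) l).integrable
    (((mulExp φ hφ l).integrable.const_mul (l v)).congr (.of_forall fun x => (hexp x).symm))
    (mulExp φ hφ l).integrable (fun x _ => φ.differentiableAt)
    (fun x _ => l.differentiableAt.cexp)
  simp only [hexp, integral_const_mul] at hparts
  rw [neg_mul, hparts, neg_neg]
  rfl

variable {d : ℕ}

theorem fourierLaplace_integral_lineDerivOp (φ : 𝓢(EuclideanSpace ℝ (Fin d), ℂ))
    (hφ : HasCompactSupport φ) (v : EuclideanSpace ℝ (Fin d)) (z : EuclideanSpace ℂ (Fin d)) :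
    fourierLaplace (SchwartzMap.integralCLM ℂ volume) (∂_{v} φ)
        (hasCompactSupport_lineDerivOp hφ v) z =
      -fourierForm d z v * fourierLaplace (SchwartzMap.integralCLM ℂ volume) φ hφ z := by
  rw [fourierLaplace, fourierLaplace, SchwartzMap.integralCLM_apply, SchwartzMap.integralCLM_apply,
    integral_mulExp_lineDerivOp volume φ hφ]
  ring

theorem norm_le_sum_norm_fourierForm_single (z : EuclideanSpace ℂ (Fin d)) :
    ‖z‖ ≤ ∑ j, ‖fourierForm d z (EuclideanSpace.single j 1)‖ := by
  have hcoord : ∀ j, ‖fourierForm d z (EuclideanSpace.single j 1)‖ = ‖z j‖ := fun j => by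
    simp [fourierForm_apply, apply_ite Complex.ofReal]
  simp only [hcoord]
  calc ‖z‖ = ‖∑ j, EuclideanSpace.single j (z j)‖ := by
        congr 1
        ext i
        simp [Pi.single_apply]
    _ ≤ ∑ j, ‖z j‖ := (norm_sum_le _ _).trans_eq (by simp)

theorem norm_fourierLaplace_integral_le (φ : 𝓢(EuclideanSpace ℝ (Fin d), ℂ))
    (hφ : HasCompactSupport φ) {z : EuclideanSpace ℂ (Fin d)} {S : ℝ}
    (hS : ∀ y ∈ tsupport φ, ⟪y, imPart z⟫ ≤ S) :
    ‖fourierLaplace (SchwartzMap.integralCLM ℂ volume) φ hφ z‖ ≤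
      ((2 * Real.pi) ^ ((d : ℝ) / 2))⁻¹ * (∫ y, ‖φ y‖) * Real.exp S := by
  rw [fourierLaplace, norm_mul, SchwartzMap.integralCLM_apply, Complex.norm_real,
    Real.norm_of_nonneg (by positivity), mul_assoc]
  gcongr
  refine (norm_integral_le_of_norm_le (φ.integrable.norm.mul_const _)
    (.of_forall fun y => ?_)).trans_eq (integral_mul_const _ _)
  rw [mulExp_apply, norm_mul, Complex.norm_exp, fourierForm_apply_re]
  by_cases hy : y ∈ tsupport φ
  · gcongr
    exact hS y hy
  · simp [image_eq_zero_of_notMem_tsupport hy]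

-- Integration by parts trades each factor `1 + ‖z‖` for first-order derivatives of `φ`.
theorem exists_one_add_norm_pow_mul_fourierLaplace_integral_le (m : ℕ)
    (φ : 𝓢(EuclideanSpace ℝ (Fin d), ℂ)) (hφ : HasCompactSupport φ) :
    ∃ C : ℝ, ∀ z S, (∀ y ∈ tsupport φ, ⟪y, imPart z⟫ ≤ S) →
      (1 + ‖z‖) ^ m * ‖fourierLaplace (SchwartzMap.integralCLM ℂ volume) φ hφ z‖ ≤
        C * Real.exp S := by
  induction m generalizing φ with
  | zero =>
    exact ⟨_, fun z S hS => by simpa using norm_fourierLaplace_integral_le φ hφ hS⟩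
  | succ m ih =>
    obtain ⟨C, hC⟩ := ih φ hφ
    choose D hD using fun j : Fin d => ih (∂_{EuclideanSpace.single j (1 : ℝ)} φ)
      (hasCompactSupport_lineDerivOp hφ _)
    refine ⟨C + ∑ j, D j, fun z S hS => ?_⟩
    set L := ‖fourierLaplace (SchwartzMap.integralCLM ℂ volume) φ hφ z‖
    have hderiv : ∀ j, (1 + ‖z‖) ^ m * (‖fourierForm d z (EuclideanSpace.single j 1)‖ * L) ≤
        D j * Real.exp S := fun j => by
      have h := hD j z S fun y hy => hS y (SchwartzMap.tsupport_lineDerivOp_subset _ φ hy)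
      rwa [fourierLaplace_integral_lineDerivOp, norm_mul, norm_neg] at h
    calc (1 + ‖z‖) ^ (m + 1) * L
        ≤ (1 + ‖z‖) ^ m * (1 + ∑ j, ‖fourierForm d z (EuclideanSpace.single j 1)‖) * L := by
          rw [pow_succ]
          gcongr
          exact norm_le_sum_norm_fourierForm_single z
      _ = (1 + ‖z‖) ^ m * L +
          ∑ j, (1 + ‖z‖) ^ m * (‖fourierForm d z (EuclideanSpace.single j 1)‖ * L) := by
          rw [← Finset.mul_sum, ← Finset.sum_mul]
          ring
      _ ≤ C * Real.exp S + ∑ j, D j * Real.exp S :=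
          add_le_add (hC z S hS) (Finset.sum_le_sum fun j _ => hderiv j)
      _ = (C + ∑ j, D j) * Real.exp S := by rw [← Finset.sum_mul, add_mul]

end TestFunctions

section ContourShift

open Filter Topology

theorem differentiable_integral_of_locally_dominated {E : Type*} [TopologicalSpace E]
    [MeasurableSpace E] [BorelSpace E] [SecondCountableTopology E] {μ : Measure E} {W : E → ℂ → ℂ}
    (hc : Continuous (Function.uncurry W)) (hd : ∀ x, Differentiable ℂ (W x))
    (hb : ∀ R : ℝ, ∃ b : E → ℝ, Integrable b μ ∧ ∀ x w, ‖w‖ ≤ R → ‖W x w‖ ≤ b x) :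
    Differentiable ℂ fun w => ∫ x, W x w ∂μ := by
  intro w₀
  obtain ⟨b, hbi, hbW⟩ := hb (‖w₀‖ + 2)
  have hW : ∀ w, Continuous fun x => W x w := fun w => hc.comp (by fun_prop : Continuous (·, w))
  have hderiv : ∀ x, ∀ w ∈ Metric.ball w₀ 1, ‖deriv (W x) w‖ ≤ b x := fun x w hw => by
    have hcauchy := Complex.norm_deriv_le_of_forall_mem_sphere_norm_le (c := w) (R := 1) (C := b x)
      one_pos (hd x).diffContOnCl fun z hz => hbW x z ?_
    · rwa [div_one] at hcauchy
    · calc ‖z‖ = ‖w₀ + (w - w₀) + (z - w)‖ := by congr 1; ring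
        _ ≤ ‖w₀‖ + ‖w - w₀‖ + ‖z - w‖ := norm_add₃_le
        _ ≤ ‖w₀‖ + 2 := by
          linarith [mem_sphere_iff_norm.1 hz, mem_ball_iff_norm.1 hw]
  exact (hasDerivAt_integral_of_dominated_loc_of_deriv_le (F := fun w x => W x w)
    (F' := fun w x => deriv (W x) w) (bound := b) (Metric.ball_mem_nhds w₀ one_pos)
    (.of_forall fun w => (hW w).aestronglyMeasurable)
    (hbi.mono' (hW w₀).aestronglyMeasurable (.of_forall fun x => hbW x w₀ (by linarith)))
    ((measurable_deriv_with_param hc).comp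
      (measurable_id.prodMk measurable_const)).aestronglyMeasurable
    (.of_forall hderiv) hbi (.of_forall fun x w _ => (hd x w).hasDerivAt)).2.differentiableAt

-- The integral is an entire function of `w` that is constant on horizontal lines, so its derivative
-- vanishes.
theorem integral_eq_of_translation_invariant {E : Type*} [NormedAddCommGroup E]
    [NormedSpace ℝ E] [MeasurableSpace E] [BorelSpace E] [SecondCountableTopology E]
    {μ : Measure E} [μ.IsAddRightInvariant] {W : E → ℂ → ℂ}
    (hc : Continuous (Function.uncurry W)) (hd : ∀ x, Differentiable ℂ (W x))
    (hb : ∀ R : ℝ, ∃ b : E → ℝ, Integrable b μ ∧ ∀ x w, ‖w‖ ≤ R → ‖W x w‖ ≤ b x) (v : E)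
    (hv : ∀ x w (s : ℝ), W x (w + s) = W (x + s • v) w) (w w' : ℂ) :
    ∫ x, W x w ∂μ = ∫ x, W x w' ∂μ := by
  have hJ := differentiable_integral_of_locally_dominated (μ := μ) hc hd hb
  refine is_const_of_deriv_eq_zero hJ (fun w => ?_) w w'
  have hconst : (fun s : ℝ => ∫ x, W x (w + s) ∂μ) = fun _ => ∫ x, W x w ∂μ := by
    ext s
    simp_rw [hv]
    exact integral_add_right_eq_self (fun x => W x w) (s • v)
  have hreal : HasDerivAt (fun s : ℝ => ∫ x, W x (w + s) ∂μ)
      (deriv (fun w => ∫ x, W x w ∂μ) w) 0 := by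
    have hJw : HasDerivAt (fun w => ∫ x, W x w ∂μ) (deriv (fun w => ∫ x, W x w ∂μ) w)
        (w + (0 : ℝ)) := by
      rw [Complex.ofReal_zero, add_zero]
      exact (hJ w).hasDerivAt
    exact (hJw.comp_const_add w ((0 : ℝ) : ℂ)).comp_ofReal
  rw [hconst] at hreal
  exact hreal.unique (hasDerivAt_const _ _)

variable {d : ℕ}

theorem integrable_inv_one_add_norm_pow (d : ℕ) :
    Integrable fun x : EuclideanSpace ℝ (Fin d) => ((1 + ‖x‖) ^ (d + 1))⁻¹ := by
  have h := integrable_one_add_norm (E := EuclideanSpace ℝ (Fin d)) (μ := volume)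
    (r := ((d + 1 : ℕ) : ℝ)) (by rw [finrank_euclideanSpace_fin]; exact_mod_cast Nat.lt_succ_self d)
  refine h.congr (.of_forall fun x => ?_)
  dsimp only
  rw [Real.rpow_neg (by positivity), Real.rpow_natCast]

theorem continuous_realToComplex : Continuous (realToComplex (d := d)) := by
  unfold realToComplex
  fun_prop

theorem realToComplex_add_smul (x y : EuclideanSpace ℝ (Fin d)) (s : ℝ) :
    realToComplex (x + s • y) = realToComplex x + (s : ℂ) • realToComplex y := by
  ext j
  simp [realToComplex]

theorem imPart_realToComplex_add_smul (x y : EuclideanSpace ℝ (Fin d)) (w : ℂ) :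
    imPart (realToComplex x + w • realToComplex y) = w.im • y := by
  ext j
  simp [realToComplex, imPart]

theorem one_add_norm_le_mul_one_add_norm (x y : EuclideanSpace ℝ (Fin d)) (w : ℂ) :
    1 + ‖x‖ ≤ (1 + ‖w‖ * ‖y‖) * (1 + ‖realToComplex x + w • realToComplex y‖) := by
  have h := norm_le_add_norm_add (realToComplex x) (w • realToComplex y)
  rw [norm_smul, norm_realToComplex, norm_realToComplex] at h
  nlinarith [mul_nonneg (mul_nonneg (norm_nonneg w) (norm_nonneg y))
    (norm_nonneg (realToComplex x + w • realToComplex y))]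

theorem norm_le_mul_inv_one_add_norm_pow {G : EuclideanSpace ℂ (Fin d) → ℂ} {B R : ℝ} {m : ℕ}
    {x y : EuclideanSpace ℝ (Fin d)} {w : ℂ} (hw : ‖w‖ ≤ R)
    (hB : (1 + ‖realToComplex x + w • realToComplex y‖) ^ m *
      ‖G (realToComplex x + w • realToComplex y)‖ ≤ B) :
    ‖G (realToComplex x + w • realToComplex y)‖ ≤
      (1 + R * ‖y‖) ^ m * B * ((1 + ‖x‖) ^ m)⁻¹ := by
  have hR : 0 ≤ R := (norm_nonneg w).trans hw
  set z := realToComplex x + w • realToComplex y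
  rw [← div_eq_mul_inv, le_div_iff₀ (by positivity)]
  calc ‖G z‖ * (1 + ‖x‖) ^ m
      ≤ ‖G z‖ * ((1 + R * ‖y‖) * (1 + ‖z‖)) ^ m := by
        gcongr
        exact (one_add_norm_le_mul_one_add_norm x y w).trans (by gcongr)
    _ = (1 + R * ‖y‖) ^ m * ((1 + ‖z‖) ^ m * ‖G z‖) := by rw [mul_pow]; ring
    _ ≤ (1 + R * ‖y‖) ^ m * B := by gcongr

theorem integral_realToComplex_add_I_smul {G : EuclideanSpace ℂ (Fin d) → ℂ}
    (hG : Differentiable ℂ G)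
    (hb : ∀ R : ℝ, ∃ B : ℝ, ∀ z, ‖imPart z‖ ≤ R → (1 + ‖z‖) ^ (d + 1) * ‖G z‖ ≤ B)
    (y : EuclideanSpace ℝ (Fin d)) :
    ∫ x, G (realToComplex x + Complex.I • realToComplex y) = ∫ x, G (realToComplex x) := by
  have hdom : ∀ R : ℝ, ∃ b : EuclideanSpace ℝ (Fin d) → ℝ, Integrable b ∧
      ∀ x (w : ℂ), ‖w‖ ≤ R → ‖G (realToComplex x + w • realToComplex y)‖ ≤ b x := fun R => by
    obtain ⟨B, hB⟩ := hb (R * ‖y‖)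
    refine ⟨_, (integrable_inv_one_add_norm_pow d).const_mul ((1 + R * ‖y‖) ^ (d + 1) * B),
      fun x w hw => norm_le_mul_inv_one_add_norm_pow hw (hB _ ?_)⟩
    rw [imPart_realToComplex_add_smul, norm_smul, Real.norm_eq_abs]
    gcongr
    exact (Complex.abs_im_le_norm w).trans hw
  have hcont : Continuous fun p : EuclideanSpace ℝ (Fin d) × ℂ =>
      realToComplex p.1 + p.2 • realToComplex y :=
    (continuous_realToComplex.comp continuous_fst).add (continuous_snd.smul continuous_const)
  have hshift := integral_eq_of_translation_invariant (μ := volume)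
    (W := fun x w => G (realToComplex x + w • realToComplex y)) (hG.continuous.comp hcont)
    (fun x => hG.comp (by fun_prop)) hdom y
    (fun x w s => by rw [realToComplex_add_smul, add_smul, add_assoc, add_comm (w • _)])
    Complex.I 0
  simpa only [zero_smul, add_zero] using hshift

theorem norm_le_norm_realToComplex_add_I_smul (x y : EuclideanSpace ℝ (Fin d)) :
    ‖x‖ ≤ ‖realToComplex x + Complex.I • realToComplex y‖ := by
  have hx : imPart (Complex.I • (realToComplex x + Complex.I • realToComplex y)) = x := by
    ext j
    simp [imPart, realToComplex]
  simpa only [hx, norm_smul, Complex.norm_I, one_mul] using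
    norm_imPart_le (Complex.I • (realToComplex x + Complex.I • realToComplex y))

theorem integral_realToComplex_eq_zero_of_exp_decay {G : EuclideanSpace ℂ (Fin d) → ℂ}
    (hG : Differentiable ℂ G)
    (hb : ∀ R : ℝ, ∃ B : ℝ, ∀ z, ‖imPart z‖ ≤ R → (1 + ‖z‖) ^ (d + 1) * ‖G z‖ ≤ B)
    {v : EuclideanSpace ℝ (Fin d)} {C ε : ℝ} (hε : 0 < ε)
    (hdecay : ∀ t, 0 ≤ t → ∀ z, imPart z = t • v →
      (1 + ‖z‖) ^ (d + 1) * ‖G z‖ ≤ C * Real.exp (-(t * ε))) :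
    ∫ x, G (realToComplex x) = 0 := by
  set K := ∫ x : EuclideanSpace ℝ (Fin d), ((1 + ‖x‖) ^ (d + 1))⁻¹
  have hbound : ∀ t, 0 ≤ t → ‖∫ x, G (realToComplex x)‖ ≤ C * K * Real.exp (-(t * ε)) := by
    intro t ht
    rw [← integral_realToComplex_add_I_smul hG hb (t • v), mul_right_comm, ← integral_const_mul]
    refine norm_integral_le_of_norm_le ((integrable_inv_one_add_norm_pow d).const_mul _)
      (.of_forall fun x => ?_)
    rw [← div_eq_mul_inv, le_div_iff₀ (by positivity), mul_comm]
    refine le_trans ?_ (hdecay t ht (realToComplex x + Complex.I • realToComplex (t • v)) ?_)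
    · gcongr
      exact norm_le_norm_realToComplex_add_I_smul x (t • v)
    · rw [imPart_realToComplex_add_smul, Complex.I_im, one_smul]
  have hlim : Tendsto (fun t : ℝ => C * K * Real.exp (-(t * ε))) atTop (𝓝 0) := by
    simpa only [mul_zero, Function.comp_def, id] using (Real.tendsto_exp_neg_atTop_nhds_zero.comp
      (tendsto_id.atTop_mul_const hε)).const_mul (C * K)
  exact norm_le_zero_iff.1 (ge_of_tendsto hlim ((eventually_ge_atTop 0).mono hbound))

end ContourShift

section Vanishing

open Distribution Metric

variable {d : ℕ} {A : Set (EuclideanSpace ℝ (Fin d))}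

theorem supportingFunction_smul_le (hA : IsCompact A) (hA0 : A.Nonempty) {t : ℝ} (ht : 0 ≤ t)
    (y : EuclideanSpace ℝ (Fin d)) :
    supportingFunction A (t • y) ≤ t * supportingFunction A y := by
  refine csSup_le (hA0.image _) ?_
  rintro _ ⟨a, ha, rfl⟩
  dsimp only
  rw [inner_smul_right]
  exact mul_le_mul_of_nonneg_left (inner_le_supportingFunction hA ha y) ht

theorem supportingFunction_le_mul_norm (hA0 : A.Nonempty) {r : ℝ} (hr : ∀ a ∈ A, ‖a‖ ≤ r)
    (y : EuclideanSpace ℝ (Fin d)) : supportingFunction A y ≤ r * ‖y‖ := by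
  refine csSup_le (hA0.image _) ?_
  rintro _ ⟨a, ha, rfl⟩
  exact (real_inner_le_norm a y).trans (by gcongr; exact hr a ha)

theorem imPart_neg (z : EuclideanSpace ℂ (Fin d)) : imPart (-z) = -imPart z := by
  ext j
  simp [imPart]

variable {F : EuclideanSpace ℂ (Fin d) → ℂ} {C : ℝ} {N : ℕ}

theorem exists_one_add_norm_pow_mul_norm_mul_fourierLaplace_le
    (hFb : ∀ z, ‖F z‖ ≤ C * (1 + ‖z‖) ^ N * Real.exp (supportingFunction A (imPart z)))
    (φ : 𝓢(EuclideanSpace ℝ (Fin d), ℂ)) (hφ : HasCompactSupport φ) (m : ℕ) :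
    ∃ B : ℝ, ∀ z S, (∀ y ∈ tsupport φ, -⟪y, imPart z⟫ ≤ S) →
      (1 + ‖z‖) ^ m * ‖F z * fourierLaplace (SchwartzMap.integralCLM ℂ volume) φ hφ (-z)‖ ≤
        B * Real.exp (supportingFunction A (imPart z) + S) := by
  obtain ⟨D, hD⟩ := exists_one_add_norm_pow_mul_fourierLaplace_integral_le (N + m) φ hφ
  have hC : 0 ≤ C := by
    have h := (norm_nonneg _).trans (hFb 0)
    rw [norm_zero, add_zero, one_pow, mul_one] at h
    exact nonneg_of_mul_nonneg_left h (Real.exp_pos _)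
  refine ⟨C * D, fun z S hS => ?_⟩
  have hDz := hD (-z) S fun y hy => by simpa only [imPart_neg, inner_neg_right] using hS y hy
  rw [norm_neg] at hDz
  set L := ‖fourierLaplace (SchwartzMap.integralCLM ℂ volume) φ hφ (-z)‖
  set s := supportingFunction A (imPart z)
  calc (1 + ‖z‖) ^ m * ‖F z * fourierLaplace (SchwartzMap.integralCLM ℂ volume) φ hφ (-z)‖
      ≤ (1 + ‖z‖) ^ m * (C * (1 + ‖z‖) ^ N * Real.exp s * L) := by
        rw [norm_mul]
        gcongr
        exact hFb z
    _ = C * Real.exp s * ((1 + ‖z‖) ^ (N + m) * L) := by rw [pow_add]; ring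
    _ ≤ C * Real.exp s * (D * Real.exp S) := by gcongr
    _ = C * D * Real.exp (s + S) := by rw [Real.exp_add]; ring

theorem integral_mul_fourierSchwartzInv_eq_zero (hA : IsCompact A) (hA0 : A.Nonempty)
    (hF : Differentiable ℂ F)
    (hFb : ∀ z, ‖F z‖ ≤ C * (1 + ‖z‖) ^ N * Real.exp (supportingFunction A (imPart z)))
    (φ : 𝓢(EuclideanSpace ℝ (Fin d), ℂ)) (hφ : HasCompactSupport φ)
    {v : EuclideanSpace ℝ (Fin d)} {ε : ℝ} (hε : 0 < ε)
    (hφv : ∀ y ∈ tsupport φ, supportingFunction A v + ε ≤ ⟪y, v⟫) :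
    ∫ x, F (realToComplex x) * fourierSchwartzInv d φ x = 0 := by
  obtain ⟨B, hB⟩ := exists_one_add_norm_pow_mul_norm_mul_fourierLaplace_le hFb φ hφ (d + 1)
  obtain ⟨r, hr⟩ := hA.isBounded.exists_norm_le
  obtain ⟨ρ, hρ⟩ := hφ.isBounded.exists_norm_le
  set L := fourierLaplace (SchwartzMap.integralCLM ℂ volume) φ hφ
  have hstrip : ∀ R : ℝ, ∃ B' : ℝ, ∀ z, ‖imPart z‖ ≤ R →
      (1 + ‖z‖) ^ (d + 1) * ‖F z * L (-z)‖ ≤ B' := fun R => by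
    refine ⟨|B| * Real.exp (|r| * R + |ρ| * R), fun z hz =>
      (hB z (|ρ| * R) fun y hy => ?_).trans ?_⟩
    · calc -⟪y, imPart z⟫ ≤ ‖y‖ * ‖imPart z‖ := (neg_le_abs _).trans (abs_real_inner_le_norm _ _)
        _ ≤ |ρ| * R := by
          gcongr
          exact (hρ y hy).trans (le_abs_self ρ)
    · gcongr
      · exact le_abs_self B
      · exact (supportingFunction_le_mul_norm hA0 (fun a ha => (hr a ha).trans (le_abs_self r))
          _).trans (by gcongr)
  have hdecay : ∀ t, 0 ≤ t → ∀ z, imPart z = t • v →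
      (1 + ‖z‖) ^ (d + 1) * ‖F z * L (-z)‖ ≤ |B| * Real.exp (-(t * ε)) := fun t ht z hz => by
    refine (hB z (-(t * (supportingFunction A v + ε))) fun y hy => ?_).trans ?_
    · rw [hz, inner_smul_right]
      exact neg_le_neg (mul_le_mul_of_nonneg_left (hφv y hy) ht)
    · rw [hz]
      gcongr
      · exact le_abs_self B
      · linarith [supportingFunction_smul_le hA hA0 ht v]
  have hreal : ∀ x, L (-realToComplex x) = fourierSchwartzInv d φ x := fun x => by
    rw [fourierSchwartzInv_apply, fourierSchwartz_eq_fourierLaplace φ hφ]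
    congr 1
    ext j
    simp [realToComplex]
  simpa only [hreal] using integral_realToComplex_eq_zero_of_exp_decay (G := fun z => F z * L (-z))
    (hF.mul ((differentiable_fourierLaplace _ φ hφ).comp differentiable_id.neg)) hstrip hε hdecay

theorem IsFourierTransformOf.dsupport_subset {f : EuclideanSpace ℝ (Fin d) → ℂ}
    {T : 𝓢'(EuclideanSpace ℝ (Fin d), ℂ)} (hf : IsFourierTransformOf f T) (hA0 : A.Nonempty)
    (hA : IsCompact A) (hAc : Convex ℝ A) (hE : ExtendsEntireWithBound A f N) :
    dsupport T ⊆ A := by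
  obtain ⟨F, hF, hFx, C, hFb⟩ := hE
  intro x₀ hx₀
  by_contra hxA
  refine (notMem_dsupport_iff (f := T) x₀).2 ?_ hx₀
  obtain ⟨l, u, hlA, hlx⟩ := geometric_hahn_banach_closed_point hAc hA.isClosed hxA
  set v := (InnerProductSpace.toDual ℝ (EuclideanSpace ℝ (Fin d))).symm l with hv
  have hlv : ∀ y, l y = ⟪y, v⟫ := fun y => by
    rw [real_inner_comm, hv, InnerProductSpace.toDual_symm_apply]
  have hAv : supportingFunction A v ≤ u := by
    refine csSup_le (hA0.image _) ?_
    rintro _ ⟨a, ha, rfl⟩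
    exact (hlv a).symm.trans_le (hlA a ha).le
  refine ⟨{y | (u + l x₀) / 2 < l y} ∩ ball x₀ 1, fun φ hφ => ?_,
    (isOpen_lt continuous_const l.continuous).inter isOpen_ball,
    ⟨by rw [Set.mem_ofPred_eq]; linarith, mem_ball_self one_pos⟩⟩
  have hφc : HasCompactSupport φ := (isCompact_closedBall x₀ 1).of_isClosed_subset
    (isClosed_tsupport _) fun y hy => ball_subset_closedBall (hφ hy).2
  have hzero := integral_mul_fourierSchwartzInv_eq_zero hA hA0 hF hFb φ hφc
    (half_pos (sub_pos.2 hlx)) fun y hy => by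
      have hly : (u + l x₀) / 2 < l y := (hφ hy).1
      rw [← hlv y]
      linarith
  simp_rw [hFx] at hzero
  rwa [← (hf.2 _).2, fourierTempered_apply, fourierSchwartz_fourierSchwartzInv] at hzero

end Vanishing

section Growth

-- Dividing `f` by `(1 + ‖x‖ ^ 2) ^ N` makes it bounded, and multiplication by this polynomial
-- preserves tempered distributions.
theorem exists_temperedDistribution_eq_integral_mul {E : Type*} [NormedAddCommGroup E]
    [InnerProductSpace ℝ E] [MeasurableSpace E] [BorelSpace E] [SecondCountableTopology E]
    {μ : Measure E} [μ.HasTemperateGrowth] {f : E → ℂ} (hfm : AEStronglyMeasurable f μ)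
    {C : ℝ} {N : ℕ} (hf : ∀ x, ‖f x‖ ≤ C * (1 + ‖x‖) ^ N) :
    ∃ S : 𝓢'(E, ℂ), ∀ φ : 𝓢(E, ℂ),
      Integrable (fun x => f x * φ x) μ ∧ S φ = ∫ x, f x * φ x ∂μ := by
  set p : E → ℂ := fun x => (((1 + ‖x‖ ^ 2) ^ N : ℝ) : ℂ)
  have hp : p.HasTemperateGrowth := by fun_prop
  have hC : 0 ≤ C := by simpa using (norm_nonneg _).trans (hf 0)
  have hbound : ∀ x, ‖(p x)⁻¹ * f x‖ ≤ C * 2 ^ N := fun x => by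
    rw [norm_mul, norm_inv, Complex.norm_real, Real.norm_of_nonneg (by positivity),
      inv_mul_le_iff₀ (by positivity)]
    calc ‖f x‖ ≤ C * (1 + ‖x‖) ^ N := hf x
      _ ≤ C * (2 * (1 + ‖x‖ ^ 2)) ^ N := by
        gcongr
        nlinarith [sq_nonneg (‖x‖ - 1)]
      _ = (1 + ‖x‖ ^ 2) ^ N * (C * 2 ^ N) := by rw [mul_pow]; ring
  have hmeas : AEStronglyMeasurable (fun x => (p x)⁻¹ * f x) μ :=
    (by fun_prop : Measurable fun x => (p x)⁻¹).aestronglyMeasurable.mul hfm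
  have hLp := memLp_top_of_bound hmeas _ (.of_forall hbound)
  have hcancel : ∀ (φ : 𝓢(E, ℂ)) x,
      (p x)⁻¹ * f x * SchwartzMap.smulLeftCLM ℂ p φ x = f x * φ x := fun φ x => by
    have hp0 : p x ≠ 0 := Complex.ofReal_ne_zero.2 (by positivity)
    rw [SchwartzMap.smulLeftCLM_apply_apply hp, smul_eq_mul]
    field_simp
  refine ⟨TemperedDistribution.smulLeftCLM ℂ p (Lp.toTemperedDistribution (hLp.toLp _)),
    fun φ => ⟨?_, ?_⟩⟩
  · simpa only [hcancel] using
      (SchwartzMap.smulLeftCLM ℂ p φ).integrable.bdd_mul hmeas (.of_forall hbound)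
  · rw [TemperedDistribution.smulLeftCLM_apply_apply, Lp.toTemperedDistribution_apply]
    refine integral_congr_ae (hLp.coeFn_toLp.mono fun x hx => ?_)
    dsimp only
    rw [hx, smul_eq_mul, mul_comm, hcancel]

variable {d : ℕ}

theorem exists_isFourierTransformOf {f : EuclideanSpace ℝ (Fin d) → ℂ} (hfc : Continuous f)
    {C : ℝ} {N : ℕ} (hf : ∀ x, ‖f x‖ ≤ C * (1 + ‖x‖) ^ N) :
    ∃ T : 𝓢'(EuclideanSpace ℝ (Fin d), ℂ), IsFourierTransformOf f T := by
  obtain ⟨S, hS⟩ :=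
    exists_temperedDistribution_eq_integral_mul (μ := volume) hfc.aestronglyMeasurable hf
  refine ⟨PointwiseConvergenceCLM.precomp ℂ (fourierSchwartzInv d) S, hfc,
    fun φ => ⟨(hS φ).1, ?_⟩⟩
  rw [fourierTempered_apply, ← (hS φ).2]
  exact congrArg S (fourierSchwartzInv_fourierSchwartz φ)

theorem ExtendsEntireWithBound.exists_isFourierTransformOf {f : EuclideanSpace ℝ (Fin d) → ℂ}
    {A : Set (EuclideanSpace ℝ (Fin d))} (hA0 : A.Nonempty) {N : ℕ}
    (hE : ExtendsEntireWithBound A f N) :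
    ∃ T : 𝓢'(EuclideanSpace ℝ (Fin d), ℂ), IsFourierTransformOf f T := by
  obtain ⟨F, hF, hFx, C, hFb⟩ := hE
  have hfc : Continuous f := by
    rw [← funext hFx]
    exact hF.continuous.comp continuous_realToComplex
  refine ComplexPaleyWiener.exists_isFourierTransformOf hfc (C := C) (N := N) fun x => ?_
  have him : imPart (realToComplex x) = 0 := by
    ext
    simp [imPart, realToComplex]
  have hzero : supportingFunction A 0 = 0 := by
    simp [supportingFunction, hA0.image_const]
  simpa only [hFx, norm_realToComplex, him, hzero, Real.exp_zero, mul_one] using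
    hFb (realToComplex x)

end Growth

end ComplexPaleyWiener

theorem mainTheorem11_general (d : ℕ) (A : Set (EuclideanSpace ℝ (Fin d)))
    (hA_nonempty : A.Nonempty) (hA_compact : IsCompact A) (hA_convex : Convex ℝ A)
    (f : EuclideanSpace ℝ (Fin d) → ℂ) :
    ((∃ T : 𝓢'(EuclideanSpace ℝ (Fin d), ℂ),
        Distribution.dsupport T ⊆ A ∧ ComplexPaleyWiener.IsFourierTransformOf f T) ↔
      ∃ N : ℕ, ComplexPaleyWiener.ExtendsEntireWithBound A f N) ∧
    ((∃ N : ℕ, ComplexPaleyWiener.ExtendsEntireWithBound A f N) →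
      ∀ T : 𝓢'(EuclideanSpace ℝ (Fin d), ℂ), ComplexPaleyWiener.IsFourierTransformOf f T →
        ∃ N : ℕ, ComplexPaleyWiener.HasOrder T N ∧
          ComplexPaleyWiener.ExtendsEntireWithBound A f N) := by
  refine ⟨⟨?_, ?_⟩, ?_⟩
  · rintro ⟨T, hT, hf⟩
    obtain ⟨N, hN⟩ := ComplexPaleyWiener.exists_hasOrder T
    exact ⟨N, hf.extendsEntireWithBound hA_compact hT hN.1⟩
  · rintro ⟨N, hE⟩
    obtain ⟨T, hf⟩ := hE.exists_isFourierTransformOf hA_nonempty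
    exact ⟨T, hf.dsupport_subset hA_nonempty hA_compact hA_convex hE, hf⟩
  · rintro ⟨M, hE⟩ T hf
    obtain ⟨N, hN⟩ := ComplexPaleyWiener.exists_hasOrder T
    have hT := hf.dsupport_subset hA_nonempty hA_compact hA_convex hE
    exact ⟨N, hN, hf.extendsEntireWithBound hA_compact hT hN.1⟩

theorem mainTheorem11 (d : ℕ) (A : Set (EuclideanSpace ℝ (Fin d)))
    (hA_nonempty : A.Nonempty) (hA_compact : IsCompact A) (hA_convex : Convex ℝ A)
    (hA_symm : ∀ a ∈ A, -a ∈ A) (f : EuclideanSpace ℝ (Fin d) → ℂ) :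
    ((∃ T : 𝓢'(EuclideanSpace ℝ (Fin d), ℂ),
        Distribution.dsupport T ⊆ A ∧ ComplexPaleyWiener.IsFourierTransformOf f T) ↔
      ∃ N : ℕ, ComplexPaleyWiener.ExtendsEntireWithBound A f N) ∧
    ((∃ N : ℕ, ComplexPaleyWiener.ExtendsEntireWithBound A f N) →
      ∀ T : 𝓢'(EuclideanSpace ℝ (Fin d), ℂ), ComplexPaleyWiener.IsFourierTransformOf f T →
        ∃ N : ℕ, ComplexPaleyWiener.HasOrder T N ∧
          ComplexPaleyWiener.ExtendsEntireWithBound A f N) := by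
  exact mainTheorem11_general d A hA_nonempty hA_compact hA_convex f
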